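/- \textbf{Concentration of random Schrödinger potentials.} Let $m,n\ge 1$ and let $(\mathbf r,\mathbf c)\in\mathbb R_{\ge 0}^m\times\mathbb R_{\ge 0}^n$ be a $\delta$-smooth margin for some $\delta>0$, that is, $N:=\sum_i\mathbf r(i)=\sum_j\mathbf c(j)>0$ and $$\frac{\delta N}{m}\le\mathbf r(i)\le\frac{N}{\delta m},\qquad \frac{\delta N}{n}\le\mathbf c(j)\le\frac{N}{\delta n}\qquad\text{for all } i,j.$$ Let $\mathbf X$ be a random $m\times n$ matrix with independent nonnegative entries and entrywise positive mean $\boldsymbol\Lambda=\mathbb E[\mathbf X]$, and suppose that for some $\sigma,R>0$ $$\mathbb E\big[|\mathbf X_{ij}-\boldsymbol\Lambda_{ij}|^q\big]\le\frac{q!}{2}\sigma^2R^{q-2}\qquad\text{for all } i,j \text{ and all integers } q\ge 2.$$ Write $\|\boldsymbol\Lambda\|_1=\sum_{i,j}\boldsymbol\Lambda_{ij}$, $\boldsymbol\Lambda_{\min}=\min_{i,j}\boldsymbol\Lambda_{ij}$, $\boldsymbol\Lambda_{\max}=\max_{i,j}\boldsymbol\Lambda_{ij}$, $m\vee n=\max(m,n)$,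 and suppose that for some $K\ge 0$ $$\left|\log\frac{\mathbf r(i)\,\mathbf c(j)\,\|\boldsymbol\Lambda\|_1}{\boldsymbol\Lambda_{ij}N^2}\right|\le K\qquad\text{for all } i,j.$$ For a nonnegative $m\times n$ matrix $\mathbf A$, say that $\mathbf A$ is scalable to $(\mathbf r,\mathbf c)$, written $\mathbf A\in\mathcal S(\mathbf r,\mathbf c)$, if there are diagonal matrices $\mathbf D_1,\mathbf D_2$ with positive diagonal such that $\mathbf D_1\mathbf A\mathbf D_2$ has row sums $\mathbf r$ and column sums $\mathbf c$; Schrödinger potentials of $\mathbf A$ are vectors $(\boldsymbol\alpha_{\mathbf A},\boldsymbol\beta_{\mathbf A})\in\mathbb R^m\times\mathbb R^n$ such that $\big(e^{\boldsymbol\alpha_{\mathbf A}(i)}\mathbf A_{ij}e^{\boldsymbol\beta_{\mathbf A}(j)}\big)_{ij}$ has row sums $\mathbf r$ and column sums $\mathbf c$. Fix $D>0$, put $\tau=(D+1)\log(m\vee n)+\log 4$ and $$\varepsilon_0=\frac{e^{2K}(m\vee n)}{\delta\|\boldsymbol\Lambda\|_1}\Big(\sigma\sqrt{2(m\vee n)\tau}+2R\tau\Big),\qquad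 C_*=1+\frac{18\,e^{8K}\|\boldsymbol\Lambda\|_1^2}{\delta^2\boldsymbol\Lambda_{\min}^2m^2n^2},$$ $$\Phi_{\boldsymbol\Lambda}=\min\left(n\,\frac{\boldsymbol\Lambda_{\min}^4}{(\sigma+R+\boldsymbol\Lambda_{\max})^4},\ \sqrt n\,\frac{\boldsymbol\Lambda_{\min}}{\sigma+R+\boldsymbol\Lambda_{\max}}\right),$$ and suppose $\varepsilon_0\le\frac{1}{50C_*^2}$. Then $\boldsymbol\Lambda$ has Schrödinger potentials, and there is an absolute constant $c>0$ (the same for all choices of the above data) such that, for any Schrödinger potentials $(\boldsymbol\alpha,\boldsymbol\beta)$ of $\boldsymbol\Lambda$, with probability at least $$1-(m\vee n)^{-D}-m^2\exp(-c\,\Phi_{\boldsymbol\Lambda})$$ the following holds: $\mathbf X\in\mathcal S(\mathbf r,\mathbf c)$, and for any Schrödinger potentials $(\boldsymbol\alpha_{\mathbf X},\boldsymbol\beta_{\mathbf X})$ of $\mathbf X$ there is $t\in\mathbb R$ with $$\max\Big(\|\boldsymbol\alpha_{\mathbf X}+t\mathbf 1-\boldsymbol\alpha\|_\infty,\ \|\boldsymbol\beta_{\mathbf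 X}-t\mathbf 1-\boldsymbol\beta\|_\infty\Big)\le 4C_*\varepsilon_0 .$$ -/

import Mathlib

open MeasureTheory ProbabilityTheory

noncomputable section

namespace Sinkhorn

variable {m n : ℕ}

/-- An `m × n` margin: nonnegative row and column vectors with the same total. -/
structure IsMargin (r : Fin m → ℝ) (c : Fin n → ℝ) : Prop where
  row_nonneg : ∀ i, 0 ≤ r i
  col_nonneg : ∀ j, 0 ≤ c j
  sum_eq : ∑ i, r i = ∑ j, c j

/-- A `δ`-smooth margin with total `N = ∑ i, r i`. The degenerate margin `N = 0` is excluded, so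
that all `r i` and `c j` are positive. -/
structure IsSmoothMargin (δ : ℝ) (r : Fin m → ℝ) (c : Fin n → ℝ) : Prop extends IsMargin r c where
  delta_pos : 0 < δ
  total_pos : 0 < ∑ i, r i
  row_bounds : ∀ i, δ * (∑ k, r k) / m ≤ r i ∧ r i ≤ (∑ k, r k) / (δ * m)
  col_bounds : ∀ j, δ * (∑ k, r k) / n ≤ c j ∧ c j ≤ (∑ k, r k) / (δ * n)

/-- The transportation polytope: nonnegative matrices with row sums `r` and column sums `c`. -/
def transportPolytope (r : Fin m → ℝ) (c : Fin n → ℝ) : Set (Matrix (Fin m) (Fin n) ℝ) :=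
  {x | (∀ i j, 0 ≤ x i j) ∧ (∀ i, ∑ j, x i j = r i) ∧ (∀ j, ∑ i, x i j = c j)}

/-- The nonnegative matrices that can be scaled to the margin `(r, c)` by positive diagonal
matrices. -/
def scalable (r : Fin m → ℝ) (c : Fin n → ℝ) : Set (Matrix (Fin m) (Fin n) ℝ) :=
  {A | (∀ i j, 0 ≤ A i j) ∧ ∃ (d₁ : Fin m → ℝ) (d₂ : Fin n → ℝ),
    (∀ i, 0 < d₁ i) ∧ (∀ j, 0 < d₂ j) ∧
      Matrix.diagonal d₁ * A * Matrix.diagonal d₂ ∈ transportPolytope r c}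

/-- `(α, β)` are Schrödinger potentials of `A` for the margin `(r, c)`:
the matrix `(exp (α i) * A i j * exp (β j))` has margin `(r, c)`. -/
def IsSchrodingerPotential (A : Matrix (Fin m) (Fin n) ℝ) (r : Fin m → ℝ) (c : Fin n → ℝ)
    (α : Fin m → ℝ) (β : Fin n → ℝ) : Prop :=
  Matrix.diagonal (fun i => Real.exp (α i)) * A * Matrix.diagonal (fun j => Real.exp (β j)) ∈
    transportPolytope r c

/-- A random matrix with independent nonnegative entries, entrywise positive mean `Λ`, and
centered moments of order `q ≥ 2` bounded by `q! / 2 * σ ^ 2 * R ^ (q - 2)`. -/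
structure IsSubexponential {Ω : Type*} [MeasurableSpace Ω] (P : Measure Ω)
    (X : Ω → Matrix (Fin m) (Fin n) ℝ) (Λ : Matrix (Fin m) (Fin n) ℝ) (σ R : ℝ) : Prop where
  measurable : ∀ i j, Measurable (fun ω => X ω i j)
  indep : iIndepFun (fun (p : Fin m × Fin n) ω => X ω p.1 p.2) P
  nonneg : ∀ i j, ∀ᵐ ω ∂P, 0 ≤ X ω i j
  integrable : ∀ i j, Integrable (fun ω => X ω i j) P
  mean : ∀ i j, ∫ ω, X ω i j ∂P = Λ i j
  mean_pos : ∀ i j, 0 < Λ i j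
  sigma_pos : 0 < σ
  R_pos : 0 < R
  moment : ∀ i j, ∀ q : ℕ, 2 ≤ q →
    Integrable (fun ω => |X ω i j - Λ i j| ^ q) P ∧
      ∫ ω, |X ω i j - Λ i j| ^ q ∂P ≤ (q.factorial : ℝ) / 2 * σ ^ 2 * R ^ (q - 2)

/-- The entrywise `ℓ¹` norm. -/
def l1Norm (A : Matrix (Fin m) (Fin n) ℝ) : ℝ := ∑ i, ∑ j, |A i j|

/-- The smallest entry (for `m, n ≥ 1`). -/
def minEntry (A : Matrix (Fin m) (Fin n) ℝ) : ℝ := ⨅ i, ⨅ j, A i j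

/-- The largest entry (for `m, n ≥ 1`). -/
def maxEntry (A : Matrix (Fin m) (Fin n) ℝ) : ℝ := ⨆ i, ⨆ j, A i j

/-- The cost of the normalized matrix relative to the product of the normalized margins is bounded
by `K`. It is used for positive `r`, `c` and `Λ`, where the logarithm is the ordinary one. -/
def BoundedCost (Λ : Matrix (Fin m) (Fin n) ℝ) (r : Fin m → ℝ) (c : Fin n → ℝ) (K : ℝ) : Prop :=
  0 ≤ K ∧ ∀ i j, |Real.log (r i * c j * l1Norm Λ / (Λ i j * (∑ k, r k) ^ 2))| ≤ K

/-- `τ = (D + 1) log (m ∨ n) + log 4`. -/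
def tau (m n : ℕ) (D : ℝ) : ℝ := (D + 1) * Real.log (max m n : ℕ) + Real.log 4

/-- The approximate scaling error `ε₀`. -/
def eps0 (Λ : Matrix (Fin m) (Fin n) ℝ) (δ K σ R D : ℝ) : ℝ :=
  Real.exp (2 * K) * (max m n : ℕ) / (δ * l1Norm Λ) *
    (σ * Real.sqrt (2 * (max m n : ℕ) * tau m n D) + 2 * R * tau m n D)

/-- The stability constant `C_*`. -/
def CStar (Λ : Matrix (Fin m) (Fin n) ℝ) (δ K : ℝ) : ℝ :=
  1 + 18 * Real.exp (8 * K) * l1Norm Λ ^ 2 /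
    (δ ^ 2 * minEntry Λ ^ 2 * (m : ℝ) ^ 2 * (n : ℝ) ^ 2)

/-- The row-alignment rate `Φ_Λ`. -/
def alignmentRate (Λ : Matrix (Fin m) (Fin n) ℝ) (σ R : ℝ) : ℝ :=
  min (n * (minEntry Λ ^ 4 / (σ + R + maxEntry Λ) ^ 4))
    (Real.sqrt n * (minEntry Λ / (σ + R + maxEntry Λ)))

/-- The event that `X` is scalable to `(r, c)` and that its Schrödinger potentials (any choice of
them) are, after a gauge shift `t`, within `η` of `(α, β)` in the sup norm. -/
def potentialEvent {Ω : Type*} (X : Ω → Matrix (Fin m) (Fin n) ℝ) (r : Fin m → ℝ)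
    (c : Fin n → ℝ) (α : Fin m → ℝ) (β : Fin n → ℝ) (η : ℝ) : Set Ω :=
  {ω | X ω ∈ scalable r c ∧
    ∀ (αX : Fin m → ℝ) (βX : Fin n → ℝ), IsSchrodingerPotential (X ω) r c αX βX →
      ∃ t : ℝ, max ‖fun i => αX i + t - α i‖ ‖fun j => βX j - t - β j‖ ≤ η}

end Sinkhorn

end

noncomputable section

namespace Sinkhorn

variable {m n : ℕ}

/-! With `g = exp α`, the column equations force `exp (β j) = c j / ∑ k, A k j * g k`, and the row
equations become the fixed-point equation `g i * scaledRowSum A c g i = r i` of a Sinkhorn sweep.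
The sweep contracts oscillation ratios as soon as all rows overlap: if every `rowOverlap` is at
least `p`, a ratio `θ` is damped by `exp (-(m * p * (1 - 1 / θ)))` (`scaledRowSum_div_le`). Only
pairs of rows matter, so zero entries, which the random matrix may have, do no harm.

If the margins of `A` are correct up to a relative error `ε`, replacing them by `(r, c)` costs a
factor `exp (6 * ε)`. Damping beats this cost once `m * p * (1 - 1 / θ)` reaches `6 * ε`. Hence some
bounded oscillation is preserved by the sweep, compactness yields a fixed point, and any potential
`α` of `A` oscillates by at most `12 * ε / (m * p)` (`exists_isSchrodingerPotential`,
`exists_shift_abs_le`).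

This is applied to the matrix `A` with entries `exp (α i) * exp (β j) * X i j`, where `(α, β)` are
potentials of `Λ`. Its mean has margins exactly `(r, c)`, and its potentials are the differences
between those of `X` and `(α, β)`. Bernstein's inequality makes its margins correct up to `eps0`; a
lower tail bound for the inner products of rows of `X` gives the overlap. The bounded cost confines
`exp (α i + β j)` between `exp (-4K)` and `exp (2K)` times `N / ‖Λ‖₁` (`potential_add_bounds`). The
upper bound enters `eps0`; the lower bound, used for two entries at a time, enters `CStar` as `exp
(8K)` (`HasApproxMargin.le_rowOverlap`, `potentials_stable`). -/

/-! ### Sinkhorn sweeps: row overlap and contraction of oscillation. -/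

def rowSum (A : Matrix (Fin m) (Fin n) ℝ) (i : Fin m) : ℝ := ∑ j, A i j

def colSum (A : Matrix (Fin m) (Fin n) ℝ) (j : Fin n) : ℝ := ∑ i, A i j

/-- The transition probabilities of the two-step chain row → column → row. -/
def rowOverlap (A : Matrix (Fin m) (Fin n) ℝ) (i k : Fin m) : ℝ :=
  ∑ j, A i j * A k j / (rowSum A i * colSum A j)

/-- The `i`-th row sum of `A` once its columns are rescaled so that
`(g k * A k j)` acquires the column sums `c`. -/
def scaledRowSum (A : Matrix (Fin m) (Fin n) ℝ) (c : Fin n → ℝ) (g : Fin m → ℝ) (i : Fin m) : ℝ :=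
  ∑ j, A i j * c j / ∑ k, A k j * g k

lemma sum_mul_pos_of_colSum_pos {A : Matrix (Fin m) (Fin n) ℝ} (hA : ∀ i j, 0 ≤ A i j)
    {j : Fin n} (hC : 0 < colSum A j) {g : Fin m → ℝ} (hg : ∀ i, 0 < g i) :
    0 < ∑ k, A k j * g k := by
  obtain ⟨k, -, hk⟩ := Finset.exists_lt_of_sum_lt (s := Finset.univ) (f := fun _ => (0 : ℝ))
    (g := fun k => A k j) (by simpa [colSum] using hC)
  exact Finset.sum_pos' (fun i _ => mul_nonneg (hA i j) (hg i).le)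
    ⟨k, Finset.mem_univ _, mul_pos hk (hg k)⟩

lemma scaledRowSum_pos {A : Matrix (Fin m) (Fin n) ℝ} (hA : ∀ i j, 0 ≤ A i j)
    (hC : ∀ j, 0 < colSum A j) {c : Fin n → ℝ} (hc : ∀ j, 0 < c j) {g : Fin m → ℝ}
    (hg : ∀ i, 0 < g i) {i : Fin m} (hi : 0 < rowSum A i) : 0 < scaledRowSum A c g i := by
  obtain ⟨j, -, hj⟩ := Finset.exists_lt_of_sum_lt (s := Finset.univ) (f := fun _ => (0 : ℝ))
    (g := fun j => A i j) (by simpa [rowSum] using hi)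
  have hs := fun j => sum_mul_pos_of_colSum_pos hA (hC j) hg
  exact Finset.sum_pos' (fun j _ => div_nonneg (mul_nonneg (hA i j) (hc j).le) (hs j).le)
    ⟨j, Finset.mem_univ _, div_pos (mul_pos hj (hc j)) (hs j)⟩

lemma sum_rowOverlap {A : Matrix (Fin m) (Fin n) ℝ} (hC : ∀ j, 0 < colSum A j)
    {i : Fin m} (hi : 0 < rowSum A i) : ∑ k, rowOverlap A i k = 1 := by
  unfold rowOverlap
  rw [Finset.sum_comm]
  have : ∀ j, ∑ k, A i j * A k j / (rowSum A i * colSum A j) = A i j / rowSum A i := by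
    intro j
    rw [← Finset.sum_div, ← Finset.mul_sum]
    change A i j * colSum A j / _ = _
    have := (hC j).ne'
    field_simp
  simp_rw [this]
  rw [← Finset.sum_div]
  exact div_self hi.ne'

lemma rowOverlap_nonneg {A : Matrix (Fin m) (Fin n) ℝ} (hA : ∀ i j, 0 ≤ A i j) (i k : Fin m) :
    0 ≤ rowOverlap A i k :=
  Finset.sum_nonneg fun _ _ => div_nonneg (mul_nonneg (hA _ _) (hA _ _))
    (mul_nonneg (Finset.sum_nonneg fun _ _ => hA _ _) (Finset.sum_nonneg fun _ _ => hA _ _))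

/-- Upper bound of the rescaled row sums by the two-step average of `1 / g`. -/
lemma scaledRowSum_le_sum_rowOverlap_div {A : Matrix (Fin m) (Fin n) ℝ} (hA : ∀ i j, 0 ≤ A i j)
    (hC : ∀ j, 0 < colSum A j) {g : Fin m → ℝ} (hg : ∀ i, 0 < g i)
    {i : Fin m} (hi : 0 < rowSum A i) :
    scaledRowSum A (colSum A) g i / rowSum A i ≤ ∑ k, rowOverlap A i k / g k := by
  -- Cauchy–Schwarz within column `j`, with weights `A k j`: the harmonic mean of `g` is at most its
  -- arithmetic mean.
  have key : ∀ j, colSum A j / ∑ k, A k j * g k ≤ (∑ k, A k j / g k) / colSum A j := by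
    intro j
    have hs := sum_mul_pos_of_colSum_pos hA (hC j) hg
    rw [div_le_div_iff₀ hs (hC j)]
    have := Finset.sum_sq_le_sum_mul_sum_of_sq_le_mul Finset.univ (r := fun k => A k j)
      (f := fun k => A k j / g k) (g := fun k => A k j * g k)
      (fun k _ => div_nonneg (hA k j) (hg k).le) (fun k _ => mul_nonneg (hA k j) (hg k).le)
      (fun k _ => by have := (hg k).ne'; apply le_of_eq; field_simp)
    rw [← sq]
    exact this
  calc scaledRowSum A (colSum A) g i / rowSum A i
      = (∑ j, A i j * (colSum A j / ∑ k, A k j * g k)) / rowSum A i := by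
        simp only [scaledRowSum, mul_div_assoc]
    _ ≤ (∑ j, A i j * ((∑ k, A k j / g k) / colSum A j)) / rowSum A i := by
        refine div_le_div_of_nonneg_right (Finset.sum_le_sum fun j _ => ?_) hi.le
        exact mul_le_mul_of_nonneg_left (key j) (hA i j)
    _ = ∑ k, rowOverlap A i k / g k := by
        simp only [rowOverlap, Finset.sum_div, Finset.mul_sum]
        rw [Finset.sum_comm]
        refine Finset.sum_congr rfl fun k _ => Finset.sum_congr rfl fun j _ => ?_
        have := (hC j).ne'
        have := (hg k).ne'
        have := hi.ne'
        field_simp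

/-- Lower bound of the rescaled row sums by the two-step average of `g`. -/
lemma one_le_scaledRowSum_mul_sum_rowOverlap {A : Matrix (Fin m) (Fin n) ℝ}
    (hA : ∀ i j, 0 ≤ A i j) (hC : ∀ j, 0 < colSum A j) {g : Fin m → ℝ} (hg : ∀ i, 0 < g i)
    {i : Fin m} (hi : 0 < rowSum A i) :
    1 ≤ scaledRowSum A (colSum A) g i / rowSum A i * ∑ k, rowOverlap A i k * g k := by
  have hs := fun j => sum_mul_pos_of_colSum_pos hA (hC j) hg
  -- Here Cauchy–Schwarz runs along row `i` instead of down a column.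
  have h := Finset.sum_sq_le_sum_mul_sum_of_sq_le_mul Finset.univ (r := fun j => A i j)
    (f := fun j => A i j * colSum A j / ∑ k, A k j * g k)
    (g := fun j => A i j * (∑ k, A k j * g k) / colSum A j)
    (fun j _ => div_nonneg (mul_nonneg (hA i j) (hC j).le) (hs j).le)
    (fun j _ => div_nonneg (mul_nonneg (hA i j) (hs j).le) (hC j).le)
    (fun j _ => by have := (hC j).ne'; have := (hs j).ne'; apply le_of_eq; field_simp)
  have e : ∑ k, rowOverlap A i k * g k
      = (∑ j, A i j * (∑ k, A k j * g k) / colSum A j) / rowSum A i := by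
    simp only [rowOverlap, Finset.sum_div, Finset.mul_sum, Finset.sum_mul]
    rw [Finset.sum_comm]
    refine Finset.sum_congr rfl fun k _ => Finset.sum_congr rfl fun j _ => ?_
    have := (hC k).ne'
    have := hi.ne'
    field_simp
  rw [e, div_mul_div_comm, le_div_iff₀ (by positivity), one_mul, ← sq]
  exact h

/-- Quantitative Birkhoff contraction of one Sinkhorn sweep, relative to the matrix `A` itself. -/
lemma scaledRowSum_div_le {A : Matrix (Fin m) (Fin n) ℝ} (hA : ∀ i j, 0 ≤ A i j)
    (hR : ∀ i, 0 < rowSum A i) (hC : ∀ j, 0 < colSum A j) {p : ℝ} (hp : ∀ i k, p ≤ rowOverlap A i k)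
    {g : Fin m → ℝ} (hg : ∀ i, 0 < g i) {θ : ℝ} (hθ : ∀ i k, g i ≤ θ * g k) (i k : Fin m) :
    scaledRowSum A (colSum A) g i / rowSum A i ≤ θ * Real.exp (-(m * p * (1 - 1 / θ))) *
      (scaledRowSum A (colSum A) g k / rowSum A k) := by
  have : Nonempty (Fin m) := ⟨i⟩
  obtain ⟨l, hl⟩ := Finite.exists_min g
  set a := g l with ha_def
  have ha : 0 < a := hg l
  have hθ1 : 1 ≤ θ := by
    have := hθ l l
    nlinarith
  have hθ0 : 0 < θ := by linarith
  set H := fun i => scaledRowSum A (colSum A) g i / rowSum A i with hH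
  have hHpos : ∀ i, 0 < H i := fun i => div_pos (scaledRowSum_pos hA hC hC hg (hR i)) (hR i)
  set s := ∑ x, (g x - a) with hs
  have hs' : ∑ x, (θ * a - g x) = m * ((θ - 1) * a) - s := by
    simp only [hs, Finset.sum_sub_distrib, Finset.sum_const, Finset.card_univ, Fintype.card_fin,
      nsmul_eq_mul]
    ring
  have up : H i ≤ 1 / a * (1 - p * s / (θ * a)) := by
    calc H i ≤ ∑ x, rowOverlap A i x / g x := scaledRowSum_le_sum_rowOverlap_div hA hC hg (hR i)
      _ ≤ ∑ x, (rowOverlap A i x * (1 / a) - p * (g x - a) / (θ * a ^ 2)) := by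
        refine Finset.sum_le_sum fun x _ => ?_
        -- The chord of the convex function `1 / x` over `[a, θ * a]`, which contains every value of
        -- `g`.
        have hx : 1 / g x ≤ 1 / a - (g x - a) / (θ * a ^ 2) := by
          have h1 := hl x
          have h2 := hθ x l
          have h3 := hg x
          have : 1 / a - (g x - a) / (θ * a ^ 2) - 1 / g x
              = (g x - a) * (θ * a - g x) / (θ * a ^ 2 * g x) := by
            field_simp
            ring
          have : 0 ≤ (g x - a) * (θ * a - g x) / (θ * a ^ 2 * g x) :=
            div_nonneg (mul_nonneg (by linarith) (by linarith)) (by positivity)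
          linarith
        have h0 : 0 ≤ (g x - a) / (θ * a ^ 2) := div_nonneg (by linarith [hl x]) (by positivity)
        have hq := rowOverlap_nonneg hA i x
        calc rowOverlap A i x / g x = rowOverlap A i x * (1 / g x) := by ring
          _ ≤ rowOverlap A i x * (1 / a - (g x - a) / (θ * a ^ 2)) := by gcongr
          _ = rowOverlap A i x * (1 / a) - rowOverlap A i x * ((g x - a) / (θ * a ^ 2)) := by ring
          _ ≤ rowOverlap A i x * (1 / a) - p * ((g x - a) / (θ * a ^ 2)) := by
            gcongr
            exact hp i x
          _ = _ := by ring
      _ = 1 / a * (1 - p * s / (θ * a)) := by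
        rw [Finset.sum_sub_distrib, ← Finset.sum_mul, sum_rowOverlap hC (hR i), ← Finset.sum_div,
          ← Finset.mul_sum, ← hs]
        field_simp
  have lo : 1 ≤ H k * (θ * a * (1 - p * (m * ((θ - 1) * a) - s) / (θ * a))) := by
    refine (one_le_scaledRowSum_mul_sum_rowOverlap hA hC hg (hR k)).trans ?_
    refine mul_le_mul_of_nonneg_left ?_ (hHpos k).le
    calc ∑ x, rowOverlap A k x * g x
        ≤ ∑ x, (rowOverlap A k x * (θ * a) - p * (θ * a - g x)) := by
          refine Finset.sum_le_sum fun x _ => ?_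
          have h2 := hθ x l
          nlinarith [mul_le_mul_of_nonneg_right (hp k x) (sub_nonneg.2 h2)]
      _ = _ := by
          rw [Finset.sum_sub_distrib, ← Finset.sum_mul, sum_rowOverlap hC (hR k),
            ← Finset.mul_sum, hs']
          field_simp
  set y := p * s / (θ * a)
  set z := p * (m * ((θ - 1) * a) - s) / (θ * a)
  -- The gaps `g x - a` and `θ * a - g x` add up to `(θ - 1) * a` in every row, so the total gain of
  -- the two one-sided estimates does not depend on `g`.
  have hyz : y + z = m * p * (1 - 1 / θ) := by
    simp only [y, z]
    field_simp
    ring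
  have hy : 0 ≤ 1 / a * (1 - y) := (hHpos i).le.trans up
  have h1y := Real.one_sub_le_exp_neg y
  have h1z := Real.one_sub_le_exp_neg z
  have hy' : 0 ≤ 1 - y := by
    rw [← mul_nonneg_iff_of_pos_left (c := 1 / a) (by positivity)]
    exact hy
  calc H i ≤ 1 / a * (1 - y) := up
    _ ≤ 1 / a * (1 - y) * (H k * (θ * a * (1 - z))) := le_mul_of_one_le_right hy lo
    _ = θ * H k * ((1 - y) * (1 - z)) := by field_simp
    _ ≤ θ * H k * ((1 - y) * Real.exp (-z)) := by
      have := hHpos k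
      gcongr
    _ ≤ θ * H k * (Real.exp (-y) * Real.exp (-z)) := by
      have := hHpos k
      gcongr
    _ = θ * Real.exp (-(m * p * (1 - 1 / θ))) * H k := by
      rw [← Real.exp_add, ← hyz, neg_add]
      ring

lemma rowSum_pos_of_overlap {A : Matrix (Fin m) (Fin n) ℝ} (hA : ∀ i j, 0 ≤ A i j) {i k : Fin m}
    (hov : ∃ j, 0 < A i j * A k j) : 0 < rowSum A i := by
  obtain ⟨j, hj⟩ := hov
  exact Finset.sum_pos' (fun j _ => hA i j)
    ⟨j, Finset.mem_univ _, pos_of_mul_pos_left hj (hA k j)⟩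

/-- One Sinkhorn sweep strictly contracts the oscillation ratio. -/
lemma scaledRowSum_mul_lt {A : Matrix (Fin m) (Fin n) ℝ} (hA : ∀ i j, 0 ≤ A i j)
    (hov : ∀ i k, ∃ j, 0 < A i j * A k j) (hC : ∀ j, 0 < colSum A j) {c : Fin n → ℝ}
    (hc : ∀ j, 0 < c j) {g w : Fin m → ℝ} (hg : ∀ i, 0 < g i) (hw : ∀ i, 0 < w i) {θ : ℝ}
    (hθ : 1 < θ) (hwθ : ∀ i k, w i ≤ θ * w k) (i k : Fin m) :
    scaledRowSum A c (fun l => g l * w l) i / scaledRowSum A c g i <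
      θ * (scaledRowSum A c (fun l => g l * w l) k / scaledRowSum A c g k) := by
  have hs := fun j => sum_mul_pos_of_colSum_pos hA (hC j) hg
  have hs' := fun j => sum_mul_pos_of_colSum_pos hA (hC j) (fun l => mul_pos (hg l) (hw l))
  have hR : ∀ i, 0 < rowSum A i := fun i => rowSum_pos_of_overlap hA (hov i i)
  -- Recentring at `g`: `B` is `A` with rows scaled by `g` and columns normalized to `c`. Sweeping
  -- `A` at `g * w` amounts to sweeping `B` at `w`, and the ratio to the row sums of `B` cancels the
  -- factor `g i`. The quantitative contraction then applies with the least overlap of `B`, positive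
  -- by finiteness.
  set B : Matrix (Fin m) (Fin n) ℝ := fun i j => g i * A i j * c j / ∑ k, A k j * g k with hB
  have hB0 : ∀ i j, 0 ≤ B i j := fun i j =>
    div_nonneg (mul_nonneg (mul_nonneg (hg i).le (hA i j)) (hc j).le) (hs j).le
  have hBC : ∀ j, colSum B j = c j := by
    intro j
    have := (hs j).ne'
    simp only [colSum, hB, ← Finset.sum_div, ← Finset.sum_mul]
    rw [div_eq_iff this, mul_comm]
    simp only [mul_comm]
  have hBR : ∀ i, rowSum B i = g i * scaledRowSum A c g i := by
    intro i
    simp only [rowSum, hB, scaledRowSum, Finset.mul_sum]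
    exact Finset.sum_congr rfl fun j _ => by ring
  have hBS : ∀ i, scaledRowSum B (colSum B) w i
      = g i * scaledRowSum A c (fun l => g l * w l) i := by
    intro i
    simp only [scaledRowSum, Finset.mul_sum, hBC]
    refine Finset.sum_congr rfl fun j _ => ?_
    have e : ∑ k, B k j * w k = c j / (∑ k, A k j * g k) * ∑ k, A k j * (g k * w k) := by
      rw [Finset.mul_sum]
      exact Finset.sum_congr rfl fun k _ => by simp only [hB]; ring
    rw [e]
    simp only [hB]
    have h1 := (hs j).ne'
    have h2 := (hs' j).ne'
    have h3 := (hc j).ne'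
    field_simp
  have hΦ : ∀ i, 0 < scaledRowSum A c g i := fun i => scaledRowSum_pos hA hC hc hg (hR i)
  have hBRpos : ∀ i, 0 < rowSum B i := fun i => by
    rw [hBR]
    exact mul_pos (hg i) (hΦ i)
  have hBCpos : ∀ j, 0 < colSum B j := fun j => by
    rw [hBC]
    exact hc j
  have hovB : ∀ i k, 0 < rowOverlap B i k := by
    intro i k
    obtain ⟨j, hj⟩ := hov i k
    refine Finset.sum_pos' (fun j _ => div_nonneg (mul_nonneg (hB0 _ _) (hB0 _ _))
      (mul_nonneg (hBRpos i).le (hBCpos j).le)) ⟨j, Finset.mem_univ _,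
        div_pos ?_ (mul_pos (hBRpos i) (hBCpos j))⟩
    have : B i j * B k j = (A i j * A k j) * (g i * g k * (c j / ∑ k, A k j * g k) ^ 2) := by
      simp only [hB]
      ring
    rw [this]
    have h1 := hs j
    have h2 := hc j
    have h3 := hg i
    have h4 := hg k
    positivity
  have : Nonempty (Fin m × Fin m) := ⟨(i, i)⟩
  obtain ⟨q, hq⟩ := Finite.exists_min (fun q : Fin m × Fin m => rowOverlap B q.1 q.2)
  have main := scaledRowSum_div_le hB0 hBRpos hBCpos (fun i k => hq (i, k)) hw hwθ i k
  have cancel : ∀ i, scaledRowSum B (colSum B) w i / rowSum B i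
      = scaledRowSum A c (fun l => g l * w l) i / scaledRowSum A c g i := fun i => by
    rw [hBS, hBR, mul_div_mul_left _ _ (hg i).ne']
  rw [cancel, cancel] at main
  have hpos : 0 < scaledRowSum A c (fun l => g l * w l) k / scaledRowSum A c g k :=
    div_pos (scaledRowSum_pos hA hC hc (fun l => mul_pos (hg l) (hw l)) (hR k)) (hΦ k)
  refine main.trans_lt (mul_lt_mul_of_pos_right ?_ hpos)
  refine mul_lt_of_lt_one_right (by linarith) (Real.exp_lt_one_iff.2 ?_)
  have hm : 0 < (m : ℝ) := by exact_mod_cast i.pos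
  have h1 : 0 < 1 - 1 / θ := by
    rw [sub_pos, div_lt_one (by linarith)]
    exact hθ
  have h2 := hovB q.1 q.2
  have : 0 < m * rowOverlap B q.1 q.2 * (1 - 1 / θ) := by positivity
  linarith

/-! ### Existence of potentials through fixed points of the sweep. -/

lemma continuousOn_scaledRowSum {A : Matrix (Fin m) (Fin n) ℝ} (hA : ∀ i j, 0 ≤ A i j)
    (hC : ∀ j, 0 < colSum A j) (c : Fin n → ℝ) (i : Fin m) :
    ContinuousOn (fun g => scaledRowSum A c g i) {g | ∀ i, 0 < g i} := by
  unfold scaledRowSum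
  refine continuousOn_finsetSum _ fun j _ => ContinuousOn.div continuousOn_const ?_ ?_
  · exact Continuous.continuousOn (by fun_prop)
  · exact fun g hg => (sum_mul_pos_of_colSum_pos hA (hC j) hg).ne'

/-- Edelstein-type fixed point: if a Sinkhorn sweep preserves some bound on the oscillation
ratio, then it has a fixed point. -/
lemma exists_scaledRowSum_fixedPoint {A : Matrix (Fin m) (Fin n) ℝ} (hA : ∀ i j, 0 ≤ A i j)
    (hov : ∀ i k, ∃ j, 0 < A i j * A k j) (hC : ∀ j, 0 < colSum A j) (hm : 0 < m)
    {r : Fin m → ℝ} {c : Fin n → ℝ} (hr : ∀ i, 0 < r i) (hc : ∀ j, 0 < c j)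
    (hrc : ∑ i, r i = ∑ j, c j) {θ : ℝ} (hθ : 1 ≤ θ)
    (hinv : ∀ g : Fin m → ℝ, (∀ i, 0 < g i) → (∀ i k, g i ≤ θ * g k) →
      ∀ i k, r i / scaledRowSum A c g i ≤ θ * (r k / scaledRowSum A c g k)) :
    ∃ g : Fin m → ℝ, (∀ i, 0 < g i) ∧ ∀ i, g i * scaledRowSum A c g i = r i := by
  have : Nonempty (Fin m) := ⟨⟨0, hm⟩⟩
  have hR : ∀ i, 0 < rowSum A i := fun i => rowSum_pos_of_overlap hA (hov i i)
  have hΦ : ∀ g : Fin m → ℝ, (∀ i, 0 < g i) → ∀ i, 0 < scaledRowSum A c g i :=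
    fun g hg i => scaledRowSum_pos hA hC hc hg (hR i)
  set S : Set (Fin m → ℝ) := Set.Icc (fun _ => 1) (fun _ => θ) with hS
  have hSpos : ∀ g ∈ S, ∀ i, 0 < g i := fun g hg i => lt_of_lt_of_le one_pos (hg.1 i)
  have hSθ : ∀ g ∈ S, ∀ i k, g i ≤ θ * g k := fun g hg i k =>
    (hg.2 i).trans (le_mul_of_one_le_right (by linarith) (hg.1 k))
  set F : (Fin m → ℝ) → Fin m → ℝ := fun g i => r i / scaledRowSum A c g i with hF
  have hFpos : ∀ g : Fin m → ℝ, (∀ i, 0 < g i) → ∀ i, 0 < F g i := fun g hg i =>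
    div_pos (hr i) (hΦ g hg i)
  -- The exponential of the Hilbert distance between `g` and its image `F g`. It is minimized over
  -- the box `S`; a minimizer with `d g > 1` would be beaten by its own image.
  set d : (Fin m → ℝ) → ℝ := fun g => (Finset.univ : Finset (Fin m × Fin m)).sup'
    Finset.univ_nonempty (fun q => (F g q.1 / g q.1) / (F g q.2 / g q.2)) with hd
  have hFc : ∀ i, ContinuousOn (fun g => F g i) S := fun i =>
    ContinuousOn.div continuousOn_const
      ((continuousOn_scaledRowSum hA hC c i).mono fun g hg => hSpos g hg)
      fun g hg => (hΦ g (hSpos g hg) i).ne'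
  have hFgc : ∀ i, ContinuousOn (fun g => F g i / g i) S := fun i =>
    (hFc i).div (continuous_apply i).continuousOn fun g hg => (hSpos g hg i).ne'
  have hdc : ContinuousOn d S := by
    refine ContinuousOn.finset_sup'_apply _ fun q _ => (hFgc q.1).div (hFgc q.2) fun g hg => ?_
    exact (div_pos (hFpos g (hSpos g hg) _) (hSpos g hg _)).ne'
  obtain ⟨g, hgS, hgmin⟩ := (isCompact_Icc : IsCompact S).exists_isMinOn
    ⟨fun _ => 1, fun _ => le_rfl, fun _ => hθ⟩ hdc
  have hg := hSpos g hgS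
  have hwpos : ∀ i, 0 < F g i / g i := fun i => div_pos (hFpos g hg i) (hg i)
  have hdle : ∀ i k, F g i / g i ≤ d g * (F g k / g k) := fun i k => by
    rw [← div_le_iff₀ (hwpos k)]
    exact Finset.le_sup' (fun q : Fin m × Fin m => (F g q.1 / g q.1) / (F g q.2 / g q.2))
      (Finset.mem_univ (i, k))
  have hd1 : d g ≤ 1 := by
    by_contra! hD
    obtain ⟨l, hl⟩ := Finite.exists_min (F g)
    have hFl := hFpos g hg l
    set w : Fin m → ℝ := fun i => F g i / g i / F g l with hw
    have hGeq : (fun i => g i * w i) = fun i => F g i / F g l := by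
      funext i
      have := (hg i).ne'
      simp only [hw]
      field_simp
    -- The sweep is homogeneous, so the image may be divided by its least coordinate; `hinv` then
    -- puts it back in the box.
    have hGS : (fun i => g i * w i) ∈ S := by
      rw [hGeq]
      refine ⟨fun i => ?_, fun i => ?_⟩
      · change 1 ≤ F g i / F g l
        rw [one_le_div hFl]
        exact hl i
      · change F g i / F g l ≤ θ
        rw [div_le_iff₀ hFl]
        exact hinv g hg (hSθ g hgS) i l
    have hGpos := hSpos _ hGS
    have key := scaledRowSum_mul_lt hA hov hC hc hg (fun i => div_pos (hwpos i) hFl) hD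
      (fun i k => by
        rw [← mul_div_assoc]
        exact div_le_div_of_nonneg_right (hdle i k) hFl.le)
    have : d (fun i => g i * w i) < d g := by
      rw [hd, Finset.sup'_lt_iff]
      rintro ⟨k, i⟩ -
      have h1 := key i k
      change scaledRowSum A c (fun l => g l * w l) i / _ <
        d g * (scaledRowSum A c (fun l => g l * w l) k / _) at h1
      change F (fun i => g i * w i) k / (g k * w k) / (F (fun i => g i * w i) i / (g i * w i)) < d g
      have e : ∀ i, F (fun i => g i * w i) i / (g i * w i) =
          F g l * (scaledRowSum A c (fun l => g l * w l) i / scaledRowSum A c g i)⁻¹ := by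
        intro i
        have h2 := (hΦ g hg i).ne'
        have h3 := (hΦ _ hGpos i).ne'
        have h4 := (hg i).ne'
        have h5 := (hr i).ne'
        have h6 := congrFun hGeq i
        rw [h6]
        have h7 := hFl.ne'
        simp only [hF] at h7 ⊢
        field_simp
      rw [e, e, mul_div_mul_left _ _ hFl.ne', inv_div_inv, div_lt_iff₀
        (div_pos (hΦ _ hGpos _) (hΦ g hg _))]
      exact h1
    exact (hgmin hGS).not_gt this
  have heq : ∀ i k, F g i / g i = F g k / g k := by
    have : ∀ i k, F g i / g i ≤ F g k / g k := fun i k =>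
      (hdle i k).trans (mul_le_of_le_one_left (hwpos k).le hd1)
    exact fun i k => le_antisymm (this i k) (this k i)
  have i₀ : Fin m := ⟨0, hm⟩
  set lam := F g i₀ / g i₀
  have hr' : ∀ i, r i = lam * (g i * scaledRowSum A c g i) := by
    intro i
    have h := heq i i₀
    have h2 := (hΦ g hg i).ne'
    have h4 := (hg i).ne'
    change F g i / g i = lam at h
    rw [← h]
    simp only [hF]
    field_simp
  have hmass : ∑ i, g i * scaledRowSum A c g i = ∑ j, c j := by
    simp only [scaledRowSum, Finset.mul_sum]
    rw [Finset.sum_comm]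
    refine Finset.sum_congr rfl fun j _ => ?_
    have h1 := (sum_mul_pos_of_colSum_pos hA (hC j) hg).ne'
    calc ∑ i, g i * (A i j * c j / ∑ k, A k j * g k)
        = (∑ i, A i j * g i) * (c j / ∑ k, A k j * g k) := by
          rw [Finset.sum_mul]
          exact Finset.sum_congr rfl fun i _ => by ring
      _ = c j := by field_simp
  -- So far `F g = lam * g` only. The column step preserves the total mass, and equality of the
  -- totals of `r` and `c` fixes the factor.
  have hlam : lam = 1 := by
    have h1 : ∑ i, r i = lam * ∑ j, c j := by
      rw [← hmass, Finset.mul_sum]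
      exact Finset.sum_congr rfl fun i _ => hr' i
    rw [hrc] at h1
    have h2 : 0 < ∑ j, c j := by
      rw [← hrc]
      exact Finset.sum_pos (fun i _ => hr i) Finset.univ_nonempty
    nlinarith
  exact ⟨g, hg, fun i => by rw [hr' i, hlam, one_mul]⟩

lemma isSchrodingerPotential_iff {A : Matrix (Fin m) (Fin n) ℝ} (hA : ∀ i j, 0 ≤ A i j)
    {r : Fin m → ℝ} {c : Fin n → ℝ} {α : Fin m → ℝ} {β : Fin n → ℝ} :
    IsSchrodingerPotential A r c α β ↔
      (∀ i, ∑ j, Real.exp (α i) * A i j * Real.exp (β j) = r i) ∧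
      ∀ j, ∑ i, Real.exp (α i) * A i j * Real.exp (β j) = c j := by
  simp only [IsSchrodingerPotential, transportPolytope, Set.mem_ofPred_eq, Matrix.mul_diagonal,
    Matrix.diagonal_mul]
  refine and_iff_right fun i j => ?_
  have := hA i j
  positivity

lemma IsSchrodingerPotential.mem_scalable {A : Matrix (Fin m) (Fin n) ℝ} (hA : ∀ i j, 0 ≤ A i j)
    {r : Fin m → ℝ} {c : Fin n → ℝ} {α : Fin m → ℝ} {β : Fin n → ℝ}
    (h : IsSchrodingerPotential A r c α β) : A ∈ scalable r c :=
  ⟨hA, _, _, fun _ => Real.exp_pos _, fun _ => Real.exp_pos _, h⟩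

lemma exists_isSchrodingerPotential_of_fixedPoint {A : Matrix (Fin m) (Fin n) ℝ}
    (hA : ∀ i j, 0 ≤ A i j) (hC : ∀ j, 0 < colSum A j) {r : Fin m → ℝ} {c : Fin n → ℝ}
    (hc : ∀ j, 0 < c j) {g : Fin m → ℝ} (hg : ∀ i, 0 < g i)
    (hfix : ∀ i, g i * scaledRowSum A c g i = r i) :
    ∃ α β, IsSchrodingerPotential A r c α β := by
  have hs := fun j => sum_mul_pos_of_colSum_pos hA (hC j) hg
  refine ⟨fun i => Real.log (g i), fun j => Real.log (c j / ∑ k, A k j * g k),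
    (isSchrodingerPotential_iff hA).2 ⟨fun i => ?_, fun j => ?_⟩⟩
  · rw [← hfix i, scaledRowSum, Finset.mul_sum]
    refine Finset.sum_congr rfl fun j _ => ?_
    rw [Real.exp_log (hg i), Real.exp_log (div_pos (hc j) (hs j))]
    ring
  · rw [Real.exp_log (div_pos (hc j) (hs j)), ← Finset.sum_mul]
    have : ∑ i, Real.exp (Real.log (g i)) * A i j = ∑ k, A k j * g k :=
      Finset.sum_congr rfl fun i _ => by rw [Real.exp_log (hg i), mul_comm]
    rw [this]
    exact mul_div_cancel₀ _ (hs j).ne'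

/-- Entrywise positive matrices have Schrödinger potentials for all positive margins. -/
lemma exists_isSchrodingerPotential_of_pos {A : Matrix (Fin m) (Fin n) ℝ} (hA : ∀ i j, 0 < A i j)
    (hm : 0 < m) (hn : 0 < n) {r : Fin m → ℝ} {c : Fin n → ℝ} (hr : ∀ i, 0 < r i)
    (hc : ∀ j, 0 < c j) (hrc : ∑ i, r i = ∑ j, c j) :
    ∃ α β, IsSchrodingerPotential A r c α β := by
  have : Nonempty (Fin m) := ⟨⟨0, hm⟩⟩
  have hA' := fun i j => (hA i j).le
  have hC : ∀ j, 0 < colSum A j := fun j =>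
    Finset.sum_pos (fun i _ => hA i j) Finset.univ_nonempty
  -- For positive entries, a bound `θ` on all ratios `r i * A k j / (r k * A i j)` controls the
  -- oscillation of the image of any `g`, whatever the oscillation of `g`.
  obtain ⟨θ, hθ⟩ := Finset.exists_le
    (Finset.univ.image fun q : Fin m × Fin m × Fin n =>
      r q.1 * A q.2.1 q.2.2 / (r q.2.1 * A q.1 q.2.2))
  have hθ' : ∀ i k j, r i * A k j ≤ max θ 1 * (r k * A i j) := fun i k j => by
    rw [← div_le_iff₀ (mul_pos (hr k) (hA i j))]
    exact (hθ _ (Finset.mem_image_of_mem _ (Finset.mem_univ (i, k, j)))).trans (le_max_left _ _)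
  have hR : ∀ i, 0 < rowSum A i := fun i => by
    have : Nonempty (Fin n) := ⟨⟨0, hn⟩⟩
    exact Finset.sum_pos (fun j _ => hA i j) Finset.univ_nonempty
  obtain ⟨g, hg, hfix⟩ := exists_scaledRowSum_fixedPoint hA'
    (fun i k => ⟨⟨0, hn⟩, mul_pos (hA _ _) (hA _ _)⟩) hC hm hr hc hrc (le_max_right θ 1) (by
      intro g hg _ i k
      have hs := fun j => sum_mul_pos_of_colSum_pos hA' (hC j) hg
      rw [← mul_div_assoc, div_le_div_iff₀ (scaledRowSum_pos hA' hC hc hg (hR i))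
        (scaledRowSum_pos hA' hC hc hg (hR k)), scaledRowSum, scaledRowSum, Finset.mul_sum,
        Finset.mul_sum]
      refine Finset.sum_le_sum fun j _ => ?_
      have h1 := hθ' i k j
      have h2 : 0 ≤ c j / ∑ k, A k j * g k := div_nonneg (hc j).le (hs j).le
      calc _ = r i * A k j * (c j / ∑ k, A k j * g k) := by ring
        _ ≤ max θ 1 * (r k * A i j) * (c j / ∑ k, A k j * g k) := by gcongr
        _ = _ := by ring)
  exact exists_isSchrodingerPotential_of_fixedPoint hA' hC hc hg hfix

/-! ### Stability for matrices with nearly correct margins. -/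

/-- The margins of `A` agree with `(r, c)` up to a relative error `ε`. -/
structure HasApproxMargin (A : Matrix (Fin m) (Fin n) ℝ) (r : Fin m → ℝ) (c : Fin n → ℝ)
    (ε : ℝ) : Prop where
  nonneg : ∀ i j, 0 ≤ A i j
  row_pos : ∀ i, 0 < r i
  col_pos : ∀ j, 0 < c j
  err_nonneg : 0 ≤ ε
  err_le : ε ≤ 1 / 50
  row : ∀ i, |rowSum A i - r i| ≤ ε * r i
  col : ∀ j, |colSum A j - c j| ≤ ε * c j

namespace HasApproxMargin

variable {A : Matrix (Fin m) (Fin n) ℝ} {r : Fin m → ℝ} {c : Fin n → ℝ} {ε : ℝ}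

lemma row_le (h : HasApproxMargin A r c ε) (i : Fin m) : rowSum A i ≤ (1 + ε) * r i := by
  have := (abs_le.1 (h.row i)).2
  linarith

lemma le_row (h : HasApproxMargin A r c ε) (i : Fin m) : (1 - ε) * r i ≤ rowSum A i := by
  have := (abs_le.1 (h.row i)).1
  linarith

lemma col_le (h : HasApproxMargin A r c ε) (j : Fin n) : colSum A j ≤ (1 + ε) * c j := by
  have := (abs_le.1 (h.col j)).2
  linarith

lemma le_col (h : HasApproxMargin A r c ε) (j : Fin n) : (1 - ε) * c j ≤ colSum A j := by
  have := (abs_le.1 (h.col j)).1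
  linarith

lemma rowSum_pos (h : HasApproxMargin A r c ε) (i : Fin m) : 0 < rowSum A i :=
  (mul_pos (by linarith [h.err_le]) (h.row_pos i)).trans_le (h.le_row i)

lemma colSum_pos (h : HasApproxMargin A r c ε) (j : Fin n) : 0 < colSum A j :=
  (mul_pos (by linarith [h.err_le]) (h.col_pos j)).trans_le (h.le_col j)

/-- The contraction relative to the margins of `A` itself is transferred to `(r, c)`. Each side of
the comparison costs `(1 + ε) / (1 - ε) ≤ exp (3 * ε)`, whence `6 * ε`. -/
lemma scaledRowSum_div_le (h : HasApproxMargin A r c ε) {p : ℝ} (hp : ∀ i k, p ≤ rowOverlap A i k)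
    {g : Fin m → ℝ} (hg : ∀ i, 0 < g i) {θ : ℝ} (hθ : ∀ i k, g i ≤ θ * g k) (i k : Fin m) :
    scaledRowSum A c g i / r i ≤ θ * Real.exp (6 * ε - m * p * (1 - 1 / θ)) *
      (scaledRowSum A c g k / r k) := by
  have hε0 := h.err_nonneg
  have hε := h.err_le
  have h1 : 0 < 1 - ε := by linarith
  have hs := fun j => sum_mul_pos_of_colSum_pos h.nonneg (h.colSum_pos j) hg
  have hθ0 : 0 < θ := by
    have := hθ i i
    have := hg i
    by_contra! hn
    nlinarith
  have main := Sinkhorn.scaledRowSum_div_le h.nonneg h.rowSum_pos h.colSum_pos hp hg hθ i k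
  set E := Real.exp (-(m * p * (1 - 1 / θ))) with hE
  have up : scaledRowSum A c g i / r i ≤ (1 + ε) / (1 - ε) *
      (scaledRowSum A (colSum A) g i / rowSum A i) := by
    have e1 : (1 - ε) * scaledRowSum A c g i ≤ scaledRowSum A (colSum A) g i := by
      simp only [scaledRowSum, Finset.mul_sum]
      refine Finset.sum_le_sum fun j _ => ?_
      rw [← mul_div_assoc]
      refine div_le_div_of_nonneg_right ?_ (hs j).le
      nlinarith [mul_le_mul_of_nonneg_left (h.le_col j) (h.nonneg i j)]
    have hpos := scaledRowSum_pos h.nonneg h.colSum_pos h.colSum_pos hg (h.rowSum_pos i)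
    rw [div_mul_div_comm, div_le_div_iff₀ (h.row_pos i) (mul_pos h1 (h.rowSum_pos i))]
    calc scaledRowSum A c g i * ((1 - ε) * rowSum A i)
        = ((1 - ε) * scaledRowSum A c g i) * rowSum A i := by ring
      _ ≤ scaledRowSum A (colSum A) g i * ((1 + ε) * r i) :=
        mul_le_mul e1 (h.row_le i) (h.rowSum_pos i).le hpos.le
      _ = _ := by ring
  have lo : scaledRowSum A (colSum A) g k / rowSum A k ≤ (1 + ε) / (1 - ε) *
      (scaledRowSum A c g k / r k) := by
    have e1 : scaledRowSum A (colSum A) g k ≤ (1 + ε) * scaledRowSum A c g k := by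
      simp only [scaledRowSum, Finset.mul_sum]
      refine Finset.sum_le_sum fun j _ => ?_
      rw [← mul_div_assoc]
      refine div_le_div_of_nonneg_right ?_ (hs j).le
      nlinarith [mul_le_mul_of_nonneg_left (h.col_le j) (h.nonneg k j)]
    have hpos := scaledRowSum_pos h.nonneg h.colSum_pos h.col_pos hg (h.rowSum_pos k)
    rw [div_mul_div_comm, div_le_div_iff₀ (h.rowSum_pos k) (mul_pos h1 (h.row_pos k))]
    calc scaledRowSum A (colSum A) g k * ((1 - ε) * r k)
        ≤ ((1 + ε) * scaledRowSum A c g k) * rowSum A k :=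
        mul_le_mul e1 (h.le_row k) (mul_pos h1 (h.row_pos k)).le (by positivity)
      _ = _ := by ring
  have hκ : (1 + ε) / (1 - ε) ≤ Real.exp (3 * ε) := by
    have h2 := Real.add_one_le_exp (3 * ε)
    refine le_trans ?_ h2
    rw [div_le_iff₀ h1]
    nlinarith
  have hκ0 : 0 ≤ (1 + ε) / (1 - ε) := by positivity
  have hΦ : 0 ≤ scaledRowSum A c g k / r k :=
    (div_pos (scaledRowSum_pos h.nonneg h.colSum_pos h.col_pos hg (h.rowSum_pos k))
      (h.row_pos k)).le
  have hE0 : 0 < E := Real.exp_pos _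
  calc scaledRowSum A c g i / r i
      ≤ (1 + ε) / (1 - ε) * (θ * E * ((1 + ε) / (1 - ε) * (scaledRowSum A c g k / r k))) :=
        up.trans (mul_le_mul_of_nonneg_left (main.trans
          (mul_le_mul_of_nonneg_left lo (by positivity))) hκ0)
    _ ≤ Real.exp (3 * ε) * (θ * E * (Real.exp (3 * ε) * (scaledRowSum A c g k / r k))) := by
        gcongr
    _ = θ * Real.exp (6 * ε - m * p * (1 - 1 / θ)) * (scaledRowSum A c g k / r k) := by
        have : Real.exp (6 * ε - m * p * (1 - 1 / θ))
            = Real.exp (3 * ε) * Real.exp (3 * ε) * E := by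
          rw [hE, ← Real.exp_add, ← Real.exp_add]
          congr 1
          ring
        rw [this]
        ring

/-- A matrix with nearly correct margins and uniformly overlapping rows is scalable. -/
lemma exists_isSchrodingerPotential (h : HasApproxMargin A r c ε) (hm : 0 < m)
    (hrc : ∑ i, r i = ∑ j, c j) {p : ℝ} (hp : ∀ i k, p ≤ rowOverlap A i k)
    (hp0 : 0 < p) (hεp : 12 * ε ≤ m * p) : ∃ α β, IsSchrodingerPotential A r c α β := by
  have hmp : 0 < m * p := by positivity
  have hε0 := h.err_nonneg
  -- The ratio `θ = 1 / (1 - a)` is the break-even point: there `m * p * (1 - 1 / θ) = 6 * ε`, so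
  -- the sweep preserves the bound `θ`.
  set a := 6 * ε / (m * p) with ha
  have ha0 : 0 ≤ a := by positivity
  have ha1 : a ≤ 1 / 2 := by
    rw [ha, div_le_iff₀ hmp]
    linarith
  have h1a : 0 < 1 - a := by linarith
  have hθ : 1 ≤ 1 / (1 - a) := by
    rw [one_le_div h1a]
    linarith
  have hov : ∀ i k, ∃ j, 0 < A i j * A k j := by
    intro i k
    by_contra! hn
    have := (hp0.trans_le (hp i k)).not_ge
    refine this (Finset.sum_nonpos fun j _ => ?_)
    exact div_nonpos_of_nonpos_of_nonneg (hn j) (mul_pos (h.rowSum_pos i) (h.colSum_pos j)).le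
  obtain ⟨g, hg, hfix⟩ := exists_scaledRowSum_fixedPoint h.nonneg hov h.colSum_pos hm h.row_pos
    h.col_pos hrc hθ (by
      intro g hg hgθ i k
      have key := h.scaledRowSum_div_le hp hg hgθ k i
      have e : 6 * ε - m * p * (1 - 1 / (1 / (1 - a))) = 0 := by
        rw [one_div_one_div, ha]
        field_simp
        ring
      rw [e, Real.exp_zero, mul_one] at key
      have hi := scaledRowSum_pos h.nonneg h.colSum_pos h.col_pos hg (h.rowSum_pos i)
      have hk := scaledRowSum_pos h.nonneg h.colSum_pos h.col_pos hg (h.rowSum_pos k)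
      have hri := h.row_pos i
      have hrk := h.row_pos k
      rw [← mul_div_assoc, div_le_div_iff₀ hrk hri] at key
      rw [← mul_div_assoc, div_le_div_iff₀ hi hk]
      nlinarith)
  exact exists_isSchrodingerPotential_of_fixedPoint h.nonneg h.colSum_pos h.col_pos hg hfix

/-- The potentials of a matrix with nearly correct margins and uniformly overlapping rows are
nearly constant. -/
lemma exists_shift_abs_le (h : HasApproxMargin A r c ε) (hm : 0 < m)
    {p : ℝ} (hp : ∀ i k, p ≤ rowOverlap A i k)
    (hp0 : 0 < p) (hεp : 12 * ε ≤ m * p) {α : Fin m → ℝ} {β : Fin n → ℝ}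
    (hαβ : IsSchrodingerPotential A r c α β) :
    ∃ t, (∀ i, |α i + t| ≤ 6 * ε / (m * p)) ∧ ∀ j, |β j - t| ≤ 6 * ε / (m * p) + 2 * ε := by
  have : Nonempty (Fin m) := ⟨⟨0, hm⟩⟩
  obtain ⟨hrow, hcol⟩ := (isSchrodingerPotential_iff h.nonneg).1 hαβ
  have hmp : 0 < m * p := by positivity
  have hε0 := h.err_nonneg
  have hε1 := h.err_le
  set g : Fin m → ℝ := fun i => Real.exp (α i) with hgdef
  have hg : ∀ i, 0 < g i := fun i => Real.exp_pos _
  have hs := fun j => sum_mul_pos_of_colSum_pos h.nonneg (h.colSum_pos j) hg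
  have hβ : ∀ j, Real.exp (β j) = c j / ∑ k, A k j * g k := by
    intro j
    rw [eq_div_iff (hs j).ne', ← hcol j, Finset.mul_sum]
    exact Finset.sum_congr rfl fun i _ => by ring
  have hfix : ∀ i, g i * scaledRowSum A c g i = r i := by
    intro i
    rw [← hrow i, scaledRowSum, Finset.mul_sum]
    refine Finset.sum_congr rfl fun j _ => ?_
    rw [hβ j]
    ring
  obtain ⟨l, hl⟩ := Finite.exists_min α
  obtain ⟨u, hu⟩ := Finite.exists_max α
  set ω := α u - α l with hω
  -- At a fixed point the normalized sweep is `exp (-α i)`. Comparing the rows of least and greatest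
  -- `α`, the factor `θ = exp ω` cancels against the oscillation itself, leaving `m * p * (1 - exp
  -- (-ω)) ≤ 6 * ε`.
  have key := h.scaledRowSum_div_le hp hg (θ := Real.exp ω) (fun i k => by
    rw [hgdef, ← Real.exp_add, Real.exp_le_exp]
    linarith [hu i, hl k]) l u
  have hq : ∀ i, scaledRowSum A c g i / r i = Real.exp (-α i) := fun i => by
    have h2 : scaledRowSum A c g i ≠ 0 :=
      (scaledRowSum_pos h.nonneg h.colSum_pos h.col_pos hg (h.rowSum_pos i)).ne'
    rw [← hfix i, Real.exp_neg]
    have := (hg i).ne'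
    change _ = (g i)⁻¹
    field_simp
  rw [hq, hq, ← Real.exp_add, ← Real.exp_add, Real.exp_le_exp, one_div, ← Real.exp_neg] at key
  have hω2 : ω ≤ 12 * ε / (m * p) := by
    set a := 6 * ε / (m * p) with ha
    have ha0 : 0 ≤ a := by positivity
    have ha1 : a ≤ 1 / 2 := by
      rw [ha, div_le_iff₀ hmp]
      linarith
    have h1 : 1 - Real.exp (-ω) ≤ a := by
      rw [ha, le_div_iff₀ hmp]
      linarith
    have h2 := Real.add_one_le_exp ω
    have h3 : Real.exp ω * Real.exp (-ω) = 1 := by rw [← Real.exp_add]; simp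
    have h4 := Real.exp_pos ω
    have h6 : 12 * ε / (m * p) = 2 * a := by
      rw [ha]
      ring
    rw [h6]
    have h7 : Real.exp ω * (1 - a) ≤ 1 := by nlinarith
    by_contra! h8
    nlinarith [mul_le_mul_of_nonneg_right h2 (show 0 ≤ 1 - a by linarith)]
  have hhalf : ω / 2 ≤ 6 * ε / (m * p) := by
    have : 12 * ε / (m * p) / 2 = 6 * ε / (m * p) := by ring
    linarith
  -- Centring `α` at its midrange halves the oscillation. The extra `2 * ε` for `β` is the logarithm
  -- of the column error.
  refine ⟨-(α u + α l) / 2, fun i => ?_, fun j => ?_⟩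
  · rw [abs_le]
    constructor <;> linarith [hu i, hl i]
  · have hlog : β j = Real.log (c j) - Real.log (∑ k, A k j * g k) := by
      rw [← Real.log_div (h.col_pos j).ne' (hs j).ne', ← hβ, Real.log_exp]
    have hC := h.colSum_pos j
    have hup : Real.log (∑ k, A k j * g k) ≤ Real.log (colSum A j) + α u := by
      rw [← Real.log_exp (α u), ← Real.log_mul hC.ne' (Real.exp_pos _).ne']
      refine Real.log_le_log (hs j) ?_
      rw [colSum, Finset.sum_mul]
      exact Finset.sum_le_sum fun k _ =>
        mul_le_mul_of_nonneg_left (Real.exp_le_exp.2 (hu k)) (h.nonneg k j)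
    have hlo : Real.log (colSum A j) + α l ≤ Real.log (∑ k, A k j * g k) := by
      rw [← Real.log_exp (α l), ← Real.log_mul hC.ne' (Real.exp_pos _).ne']
      refine Real.log_le_log (mul_pos hC (Real.exp_pos _)) ?_
      rw [colSum, Finset.sum_mul]
      exact Finset.sum_le_sum fun k _ =>
        mul_le_mul_of_nonneg_left (Real.exp_le_exp.2 (hl k)) (h.nonneg k j)
    have hc := h.col_pos j
    have hratio : Real.log (colSum A j) - Real.log (c j) = Real.log (colSum A j / c j) :=
      (Real.log_div hC.ne' hc.ne').symm
    have hx0 : 0 < colSum A j / c j := by positivity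
    have hx1 : colSum A j / c j ≤ 1 + ε := by
      rw [div_le_iff₀ hc]
      exact h.col_le j
    have hx2 : 1 - ε ≤ colSum A j / c j := by
      rw [le_div_iff₀ hc]
      exact h.le_col j
    have hy1 : Real.log (colSum A j / c j) ≤ 2 * ε := by
      have := Real.log_le_sub_one_of_pos hx0
      linarith
    have hy2 : -(2 * ε) ≤ Real.log (colSum A j / c j) := by
      have h1 := Real.one_sub_inv_le_log_of_pos hx0
      have h2 : (colSum A j / c j)⁻¹ ≤ 1 + 2 * ε := by
        rw [inv_le_iff_one_le_mul₀ hx0]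
        nlinarith
      linarith
    rw [abs_le]
    constructor <;> linarith

end HasApproxMargin

/-! ### Bernstein's inequality and a lower tail for nonnegative sums. -/

section Probability

variable {Ω : Type*} [MeasurableSpace Ω] {P : Measure Ω}

/-- Bernstein's moment condition for a centered variable. -/
structure BernsteinMoments (P : Measure Ω) (Y : Ω → ℝ) (s R : ℝ) : Prop where
  measurable : Measurable Y
  integrable : Integrable Y P
  mean : ∫ ω, Y ω ∂P = 0
  integrable_pow : ∀ q : ℕ, 2 ≤ q → Integrable (fun ω => |Y ω| ^ q) P
  moment : ∀ q : ℕ, 2 ≤ q → ∫ ω, |Y ω| ^ q ∂P ≤ (q.factorial : ℝ) / 2 * s ^ 2 * R ^ (q - 2)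

lemma BernsteinMoments.neg {Y : Ω → ℝ} {s R : ℝ} (h : BernsteinMoments P Y s R) :
    BernsteinMoments P (fun ω => -Y ω) s R where
  measurable := h.measurable.neg
  integrable := h.integrable.neg
  mean := by rw [integral_neg, h.mean, neg_zero]
  integrable_pow := by simpa only [abs_neg] using h.integrable_pow
  moment := by simpa only [abs_neg] using h.moment

lemma BernsteinMoments.const_mul {Y : Ω → ℝ} {s R : ℝ} (h : BernsteinMoments P Y s R)
    {a B : ℝ} (ha : |a| ≤ B) : BernsteinMoments P (fun ω => a * Y ω) (B * s) (B * R) where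
  measurable := h.measurable.const_mul a
  integrable := h.integrable.const_mul a
  mean := by rw [integral_const_mul, h.mean, mul_zero]
  integrable_pow q hq := by
    simp only [abs_mul, mul_pow]
    exact (h.integrable_pow q hq).const_mul _
  moment q hq := by
    simp only [abs_mul, mul_pow]
    rw [integral_const_mul]
    have h0 : 0 ≤ ∫ ω, |Y ω| ^ q ∂P := integral_nonneg fun ω => by positivity
    have hB : B ^ q = B ^ 2 * B ^ (q - 2) := by rw [← pow_add]; congr 1; omega
    have hB0 : 0 ≤ B := (abs_nonneg a).trans ha
    calc |a| ^ q * ∫ ω, |Y ω| ^ q ∂P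
        ≤ B ^ q * ((q.factorial : ℝ) / 2 * s ^ 2 * R ^ (q - 2)) := by
          gcongr
          exact h.moment q hq
      _ = _ := by rw [hB]; ring

/-- The `q + 2`-nd term of the exponential series is dominated by a geometric sequence. -/
lemma BernsteinMoments.integral_term_le {Y : Ω → ℝ} {s R : ℝ} (h : BernsteinMoments P Y s R)
    (t : ℝ) (q : ℕ) :
    ∫ ω, |t * Y ω| ^ (q + 2) / (q + 2).factorial ∂P ≤ t ^ 2 * s ^ 2 / 2 * (|t| * R) ^ q := by
  have h1 := h.moment (q + 2) (by omega)
  have hf : (0 : ℝ) < (q + 2).factorial := by positivity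
  simp only [abs_mul, mul_pow, mul_div_assoc]
  rw [integral_const_mul, integral_div]
  calc |t| ^ (q + 2) * ((∫ ω, |Y ω| ^ (q + 2) ∂P) / (q + 2).factorial)
      ≤ |t| ^ (q + 2) * (((q + 2).factorial : ℝ) / 2 * s ^ 2 * R ^ (q + 2 - 2)
          / (q + 2).factorial) := by gcongr
    _ = |t| ^ 2 * s ^ 2 / 2 * (|t| * R) ^ q := by
      rw [Nat.add_sub_cancel]
      field_simp
      ring
    _ = _ := by
      rw [sq_abs]
      ring

lemma BernsteinMoments.summable_integral_term {Y : Ω → ℝ} {s R : ℝ}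
    (h : BernsteinMoments P Y s R) {t : ℝ} (hR : 0 ≤ R) (ht : |t| * R < 1) :
    Summable fun q : ℕ => ∫ ω, |t * Y ω| ^ q / q.factorial ∂P := by
  rw [← summable_nat_add_iff 2]
  refine Summable.of_nonneg_of_le (fun q => integral_nonneg fun ω => by positivity)
    (fun q => h.integral_term_le t q) ?_
  exact (summable_geometric_of_lt_one (by positivity) ht).mul_left _

lemma tsum_pow_div_factorial (x : ℝ) : ∑' q : ℕ, x ^ q / q.factorial = Real.exp x := by
  rw [Real.exp_eq_exp_ℝ, NormedSpace.exp_eq_tsum_div]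

variable [IsProbabilityMeasure P]

lemma BernsteinMoments.integrable_abs_pow {Y : Ω → ℝ} {s R : ℝ} (h : BernsteinMoments P Y s R)
    (q : ℕ) : Integrable (fun ω => |Y ω| ^ q) P := by
  rcases Nat.lt_or_ge q 2 with hq | hq
  · interval_cases q
    · simp
    · simpa using h.integrable.abs
  · exact h.integrable_pow q hq

lemma BernsteinMoments.integrable_term {Y : Ω → ℝ} {s R : ℝ} (h : BernsteinMoments P Y s R)
    (t : ℝ) (q : ℕ) : Integrable (fun ω => |t * Y ω| ^ q / q.factorial) P := by
  simp only [abs_mul, mul_pow]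
  exact ((h.integrable_abs_pow q).const_mul _).div_const _

lemma BernsteinMoments.integrable_exp {Y : Ω → ℝ} {s R : ℝ} (h : BernsteinMoments P Y s R)
    {t : ℝ} (hR : 0 ≤ R) (ht : |t| * R < 1) : Integrable (fun ω => Real.exp (t * Y ω)) P := by
  have hsum := hasSum_integral_of_summable_integral_norm (h.integrable_term t) (by
    refine (h.summable_integral_term hR ht).congr fun q => integral_congr_ae (.of_forall fun ω => ?_)
    exact (Real.norm_of_nonneg (by positivity)).symm)
  simp only [tsum_pow_div_factorial] at hsum
  -- The Bochner integral of a non-integrable function is zero, so the lower bound by the zeroth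
  -- term of the series proves integrability.
  have h1 : 1 ≤ ∫ ω, Real.exp |t * Y ω| ∂P := by
    have := le_hasSum hsum 0 fun q _ => integral_nonneg fun ω => by positivity
    simpa using this
  have h2 : Integrable (fun ω => Real.exp |t * Y ω|) P :=
    Integrable.of_integral_ne_zero (by linarith)
  refine h2.mono' ?_ (.of_forall fun ω => ?_)
  · exact ((h.measurable.const_mul t).exp).aestronglyMeasurable
  · rw [Real.norm_of_nonneg (Real.exp_pos _).le]
    exact Real.exp_le_exp.2 (le_abs_self _)

/-- In the integrated exponential series the first-order term vanishes by centring, and the terms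
from the second on are dominated by a geometric series of ratio `|t| * R`. -/
lemma BernsteinMoments.mgf_le {Y : Ω → ℝ} {s R : ℝ} (h : BernsteinMoments P Y s R)
    {t : ℝ} (hR : 0 ≤ R) (ht : |t| * R < 1) :
    mgf Y P t ≤ Real.exp (t ^ 2 * s ^ 2 / (2 * (1 - |t| * R))) := by
  have hint : ∀ q : ℕ, Integrable (fun ω => (t * Y ω) ^ q / q.factorial) P := fun q => by
    refine (h.integrable_term t q).mono' ?_ (.of_forall fun ω => ?_)
    · exact (((h.measurable.const_mul t).pow_const q).div_const _).aestronglyMeasurable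
    · rw [norm_div, norm_pow, Real.norm_eq_abs, Real.norm_of_nonneg (by positivity)]
  have hsum := hasSum_integral_of_summable_integral_norm hint (by
    refine (h.summable_integral_term hR ht).congr fun q => integral_congr_ae (.of_forall fun ω => ?_)
    change _ = ‖_‖
    rw [norm_div, norm_pow, Real.norm_eq_abs, Real.norm_of_nonneg (by positivity)])
  simp only [tsum_pow_div_factorial] at hsum
  have hle : ∀ q : ℕ, ∫ ω, (t * Y ω) ^ (q + 2) / (q + 2).factorial ∂P
      ≤ t ^ 2 * s ^ 2 / 2 * (|t| * R) ^ q := fun q => by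
    refine (integral_mono (hint _) (h.integrable_term t _) fun ω => ?_).trans
      (h.integral_term_le t q)
    have := le_abs_self ((t * Y ω) ^ (q + 2))
    rw [abs_pow] at this
    gcongr
  have hgeo := (hasSum_geometric_of_lt_one (r := |t| * R) (by positivity) ht).mul_left
    (t ^ 2 * s ^ 2 / 2)
  have h2 := (hasSum_nat_add_iff' 2).2 hsum
  have h3 := hasSum_le hle h2 hgeo
  have h4 : ∑ i ∈ Finset.range 2, ∫ ω, (t * Y ω) ^ i / (i.factorial : ℝ) ∂P = 1 := by
    simp [Finset.sum_range_succ, integral_const_mul, h.mean]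
  rw [h4] at h3
  have h5 : 0 < 1 - |t| * R := by linarith
  have h6 : t ^ 2 * s ^ 2 / 2 * (1 - |t| * R)⁻¹ = t ^ 2 * s ^ 2 / (2 * (1 - |t| * R)) := by
    field_simp
  rw [h6] at h3
  calc mgf Y P t ≤ t ^ 2 * s ^ 2 / (2 * (1 - |t| * R)) + 1 := by
        change ∫ ω, Real.exp (t * Y ω) ∂P ≤ _
        linarith
    _ ≤ _ := Real.add_one_le_exp _

lemma bernstein_upper {ι : Type*} [Fintype ι] {Y : ι → Ω → ℝ} (hY : iIndepFun Y P) {s R : ℝ}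
    (hs : 0 < s) (hR : 0 < R) (h : ∀ j, BernsteinMoments P (Y j) s R) {M τ : ℝ}
    (hM : (Fintype.card ι : ℝ) ≤ M) (hM0 : 0 < M) (hτ : 0 < τ) :
    P.real {ω | s * Real.sqrt (2 * M * τ) + 2 * R * τ ≤ ∑ j, Y j ω} ≤ Real.exp (-τ) := by
  set x := s * Real.sqrt (2 * M * τ) + 2 * R * τ with hx
  set y := s * Real.sqrt (2 * M * τ) with hy
  have hy0 : 0 ≤ y := by positivity
  have hy2 : y ^ 2 = s ^ 2 * (2 * M * τ) := by rw [hy, mul_pow, Real.sq_sqrt (by positivity)]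
  have hx0 : 0 < x := by positivity
  set V := M * s ^ 2 with hV
  have hV0 : 0 < V := by positivity
  have hVR : 0 < V + R * x := by positivity
  -- Bernstein's usual choice: `1 - t * R = V / (V + R * x)`, and the Chernoff exponent becomes `x ^
  -- 2 / (2 * (V + R * x))`.
  set t := x / (V + R * x) with ht
  have ht0 : 0 < t := by positivity
  have htR : 1 - |t| * R = V / (V + R * x) := by
    rw [abs_of_pos ht0, ht]
    field_simp
    ring
  have htR1 : |t| * R < 1 := by
    have : 0 < V / (V + R * x) := by positivity
    linarith
  have hint := hY.integrable_exp_mul_sum (t := t) (fun j => (h j).measurable)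
    (s := Finset.univ) fun j _ => (h j).integrable_exp hR.le htR1
  have hch := measure_ge_le_exp_mul_mgf x ht0.le hint
  rw [hY.mgf_sum fun j => (h j).measurable] at hch
  have hset : {ω | x ≤ (∑ j, Y j) ω} = {ω | x ≤ ∑ j, Y j ω} := by
    simp only [Finset.sum_apply]
  rw [hset] at hch
  refine hch.trans ?_
  have hprod : ∏ j, mgf (Y j) P t ≤ Real.exp (x ^ 2 / (2 * (V + R * x))) := by
    calc ∏ j, mgf (Y j) P t
        ≤ ∏ _j : ι, Real.exp (t ^ 2 * s ^ 2 / (2 * (1 - |t| * R))) :=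
          Finset.prod_le_prod (fun j _ => mgf_nonneg) fun j _ => (h j).mgf_le hR.le htR1
      _ = Real.exp (Fintype.card ι * (t ^ 2 * s ^ 2 / (2 * (1 - |t| * R)))) := by
          rw [Finset.prod_const, Finset.card_univ, ← Real.exp_nat_mul]
      _ ≤ Real.exp (M * (t ^ 2 * s ^ 2 / (2 * (1 - |t| * R)))) := by
          have : 0 ≤ 1 - |t| * R := by linarith
          gcongr
      _ = _ := by
          rw [htR, ht, hV]
          congr 1
          field_simp
  calc Real.exp (-t * x) * ∏ j, mgf (Y j) P t
      ≤ Real.exp (-t * x) * Real.exp (x ^ 2 / (2 * (V + R * x))) := by gcongr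
    _ = Real.exp (-(x ^ 2 / (2 * (V + R * x)))) := by
        rw [← Real.exp_add, ht]
        congr 1
        field_simp
        ring
    _ ≤ Real.exp (-τ) := by
        rw [Real.exp_le_exp, neg_le_neg_iff, le_div_iff₀ (by positivity)]
        -- Since `y ^ 2 = 2 * V * τ`, the difference `x ^ 2 - 2 * τ * (V + R * x)` equals `2 * R * τ
        -- * y`, which is nonnegative.
        have : x = y + 2 * R * τ := hx
        have h1 : 0 ≤ R * τ := by positivity
        nlinarith [mul_nonneg hy0 h1]

/-- Two-sided Bernstein inequality under Bernstein's moment condition. -/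
lemma bernstein {ι : Type*} [Fintype ι] {Y : ι → Ω → ℝ} (hY : iIndepFun Y P) {s R : ℝ}
    (hs : 0 < s) (hR : 0 < R) (h : ∀ j, BernsteinMoments P (Y j) s R) {M τ : ℝ}
    (hM : (Fintype.card ι : ℝ) ≤ M) (hM0 : 0 < M) (hτ : 0 < τ) :
    P.real {ω | s * Real.sqrt (2 * M * τ) + 2 * R * τ ≤ |∑ j, Y j ω|} ≤ 2 * Real.exp (-τ) := by
  have h1 := bernstein_upper hY hs hR h hM hM0 hτ
  have h2 := bernstein_upper (Y := fun j ω => -Y j ω)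
    (hY.comp (fun _ x => -x) fun _ => measurable_neg) hs hR (fun j => (h j).neg) hM hM0 hτ
  simp only [Finset.sum_neg_distrib] at h2
  have hsub : {ω | s * Real.sqrt (2 * M * τ) + 2 * R * τ ≤ |∑ j, Y j ω|} ⊆
      {ω | s * Real.sqrt (2 * M * τ) + 2 * R * τ ≤ ∑ j, Y j ω} ∪
      {ω | s * Real.sqrt (2 * M * τ) + 2 * R * τ ≤ -∑ j, Y j ω} := by
    intro ω hω
    simp only [Set.mem_union, Set.mem_ofPred_eq] at hω ⊢
    exact le_abs.1 hω
  exact ((measureReal_mono hsub).trans (measureReal_union_le _ _)).trans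
    ((add_le_add h1 h2).trans_eq (two_mul _).symm)

/-- Lower tail of a sum of nonnegative variables with finite second moments, once the moment
generating function of the sum factors. -/
lemma lower_tail_of_mgf_sum_eq {ι : Type*} [Fintype ι] {Z : ι → Ω → ℝ}
    (hmgf : ∀ t, mgf (∑ j, Z j) P t = ∏ j, mgf (Z j) P t) (hmeas : ∀ j, Measurable (Z j))
    (hnn : ∀ j, ∀ᵐ ω ∂P, 0 ≤ Z j ω) (hint : ∀ j, Integrable (Z j) P)
    (hint2 : ∀ j, Integrable (fun ω => Z j ω ^ 2) P) {μ v : ℝ} (hμ : 0 < μ) (hv : 0 < v)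
    (hmean : ∀ j, μ ≤ ∫ ω, Z j ω ∂P) (hsq : ∀ j, ∫ ω, Z j ω ^ 2 ∂P ≤ v) :
    P.real {ω | ∑ j, Z j ω ≤ Fintype.card ι * μ / 2} ≤
      Real.exp (-(Fintype.card ι * μ ^ 2 / (8 * v))) := by
  set N : ℝ := (Fintype.card ι : ℝ)
  -- The minimizer of `t * μ / 2 + t ^ 2 * v / 2`, the Chernoff exponent per summand.
  set t := -(μ / (2 * v)) with ht
  have ht0 : t ≤ 0 := by
    have : 0 < μ / (2 * v) := by positivity
    linarith
  have hbdd : Integrable (fun ω => Real.exp (t * (∑ j, Z j) ω)) P := by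
    simp only [Finset.sum_apply]
    refine Integrable.of_bound (C := 1)
      ((Finset.measurable_sum _ fun j _ => hmeas j).const_mul t).exp.aestronglyMeasurable ?_
    filter_upwards [ae_all_iff.2 hnn] with ω hω
    rw [Real.norm_of_nonneg (Real.exp_pos _).le, Real.exp_le_one_iff]
    exact mul_nonpos_of_nonpos_of_nonneg ht0 (Finset.sum_nonneg fun j _ => hω j)
  have hch := measure_le_le_exp_mul_mgf (N * μ / 2) ht0 hbdd
  rw [hmgf] at hch
  simp only [Finset.sum_apply] at hch
  refine hch.trans ?_
  have hone : ∀ j, mgf (Z j) P t ≤ Real.exp (t * μ + t ^ 2 * v / 2) := by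
    intro j
    have hi : Integrable (fun ω => 1 + t * Z j ω + t ^ 2 / 2 * Z j ω ^ 2) P :=
      ((integrable_const 1).add ((hint j).const_mul t)).add ((hint2 j).const_mul _)
    calc mgf (Z j) P t ≤ ∫ ω, (1 + t * Z j ω + t ^ 2 / 2 * Z j ω ^ 2) ∂P := by
          refine integral_mono_of_nonneg (.of_forall fun ω => (Real.exp_pos _).le) hi ?_
          filter_upwards [hnn j] with ω hω
          have hx : 0 ≤ -t * Z j ω := mul_nonneg (by linarith) hω
          have h1 := Real.quadratic_le_exp_of_nonneg hx
          have h2 : Real.exp (t * Z j ω) = (Real.exp (-t * Z j ω))⁻¹ := by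
            rw [← Real.exp_neg]
            congr 1
            ring
          change Real.exp (t * Z j ω) ≤ _
          rw [h2]
          set x := -t * Z j ω
          have h3 : 1 + t * Z j ω + t ^ 2 / 2 * Z j ω ^ 2 = 1 - x + x ^ 2 / 2 := by
            simp only [x]
            ring
          rw [h3]
          have h4 : 0 < 1 - x + x ^ 2 / 2 := by nlinarith [sq_nonneg (x - 1)]
          rw [inv_le_iff_one_le_mul₀ (Real.exp_pos _)]
          -- The product is `1 + x ^ 4 / 4`; this turns the quadratic lower bound for `exp x` into
          -- `exp (-x) ≤ 1 - x + x ^ 2 / 2`.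
          calc (1 : ℝ) ≤ (1 - x + x ^ 2 / 2) * (1 + x + x ^ 2 / 2) := by
                nlinarith [sq_nonneg (x ^ 2)]
            _ ≤ _ := by gcongr
      _ = 1 + t * (∫ ω, Z j ω ∂P) + t ^ 2 / 2 * ∫ ω, Z j ω ^ 2 ∂P := by
          have h1 : Integrable (fun ω => t * Z j ω) P := (hint j).const_mul t
          have h2 : Integrable (fun ω => 1 + t * Z j ω) P := (integrable_const 1).add h1
          rw [integral_add h2 ((hint2 j).const_mul _), integral_add (integrable_const 1) h1,
            integral_const_mul, integral_const_mul]
          simp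
      _ ≤ 1 + t * μ + t ^ 2 / 2 * v := by
          have h1 := mul_le_mul_of_nonpos_left (hmean j) ht0
          have h2 : t ^ 2 / 2 * ∫ ω, Z j ω ^ 2 ∂P ≤ t ^ 2 / 2 * v := by
            gcongr
            exact hsq j
          linarith
      _ ≤ _ := by
          have := Real.add_one_le_exp (t * μ + t ^ 2 * v / 2)
          linarith
  calc Real.exp (-t * (N * μ / 2)) * ∏ j, mgf (Z j) P t
      ≤ Real.exp (-t * (N * μ / 2)) * ∏ _j : ι, Real.exp (t * μ + t ^ 2 * v / 2) := by
        gcongr with j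
        · exact fun j _ => mgf_nonneg
        · exact hone j
    _ = Real.exp (-t * (N * μ / 2)) * Real.exp (N * (t * μ + t ^ 2 * v / 2)) := by
        rw [Finset.prod_const, Finset.card_univ, ← Real.exp_nat_mul]
    _ = _ := by
        rw [← Real.exp_add, ht]
        congr 1
        field_simp
        ring

/-- The inner product of two rows of an independent array has a moment generating function that
factors over the columns. -/
lemma mgf_sum_row_mul_row {ι κ : Type*} [DecidableEq ι] [DecidableEq κ]
    {X : ι → κ → Ω → ℝ} (hX : iIndepFun (fun (p : ι × κ) => X p.1 p.2) P)
    (hmeas : ∀ i j, Measurable (X i j)) (i k : ι) (s : Finset κ) (t : ℝ) :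
    mgf (∑ j ∈ s, X i j * X k j) P t = ∏ j ∈ s, mgf (X i j * X k j) P t := by
  induction s using Finset.induction_on with
  | empty => simp
  | insert j₀ s hj₀ ih =>
    have hm : ∀ j, Measurable (X i j * X k j) := fun j => (hmeas i j).mul (hmeas k j)
    have hms : Measurable (∑ j ∈ s, X i j * X k j) := by
      have := Finset.measurable_sum s fun j _ => hm j
      simpa only [← Finset.sum_apply] using this
    have hind : IndepFun (X i j₀ * X k j₀) (∑ j ∈ s, X i j * X k j) P := by
      -- The new summand and the partial sum depend on disjoint sets of columns, hence on disjoint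
      -- blocks of the array.
      have hd : Disjoint (({i, k} : Finset ι) ×ˢ ({j₀} : Finset κ))
          (({i, k} : Finset ι) ×ˢ s) :=
        Finset.disjoint_product.2 (Or.inr (Finset.disjoint_singleton_left.2 hj₀))
      have h := hX.indepFun_finset _ _ hd fun p => hmeas p.1 p.2
      have h' := h.comp
        (φ := fun x : (({i, k} : Finset ι) ×ˢ ({j₀} : Finset κ)) → ℝ => x ⟨(i, j₀), by simp⟩ * x ⟨(k, j₀), by simp⟩)
        (ψ := fun x : (({i, k} : Finset ι) ×ˢ s) → ℝ => ∑ j ∈ s.attach,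
          x ⟨(i, j.1), by simp [j.2]⟩ * x ⟨(k, j.1), by simp [j.2]⟩)
        (by fun_prop) (by fun_prop)
      have e : (∑ j ∈ s, X i j * X k j) = fun ω => ∑ j ∈ s.attach, X i j ω * X k j ω := by
        ext ω
        simp only [Finset.sum_apply, Pi.mul_apply]
        exact (Finset.sum_attach s fun j => X i j ω * X k j ω).symm
      rw [e]
      exact h'
    rw [Finset.sum_insert hj₀, Finset.prod_insert hj₀, hind.mgf_add
      ((hm j₀).const_mul t).exp.aestronglyMeasurable (hms.const_mul t).exp.aestronglyMeasurable, ih]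

end Probability

/-! ### A priori bounds on the potentials under bounded cost. -/

/-- Jensen bound for one potential in terms of the mean of the other. -/
lemma potential_mul_add_le {A : Matrix (Fin m) (Fin n) ℝ} (hA : ∀ i j, 0 < A i j)
    {r : Fin m → ℝ} {c : Fin n → ℝ} (hr : ∀ i, 0 < r i) (hc : ∀ j, 0 < c j) {N L K : ℝ}
    (hN : 0 < N) (hcN : ∑ j, c j = N)
    (hK : ∀ i j, |Real.log (A i j) + Real.log N - Real.log (r i) - Real.log (c j) - L| ≤ K)
    {α : Fin m → ℝ} {β : Fin n → ℝ}
    (hrow : ∀ i, ∑ j, Real.exp (α i) * A i j * Real.exp (β j) = r i) (i : Fin m) :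
    N * α i + ∑ j, c j * β j + N * L ≤ N * K := by
  -- This is `log x ≤ x - 1` at the density of the scaled entry with respect to `r i * c j / N`.
  -- After summation over `j` the right-hand side cancels by the `i`-th row equation.
  have key : ∀ j, c j * (α i + β j + L - K) ≤
      N / r i * (Real.exp (α i) * A i j * Real.exp (β j)) - c j := by
    intro j
    have h1 := (abs_le.1 (hK i j)).1
    have hx : 0 < Real.exp (α i) * A i j * Real.exp (β j) * N / (r i * c j) := by
      have := hA i j
      have := hr i
      have := hc j
      positivity
    have h2 := Real.log_le_sub_one_of_pos hx
    rw [Real.log_div (by have := hA i j; positivity) (mul_pos (hr i) (hc j)).ne',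
      Real.log_mul (by have := hA i j; positivity) hN.ne',
      Real.log_mul (by have := hA i j; positivity) (Real.exp_pos _).ne',
      Real.log_mul (Real.exp_pos _).ne' (hA i j).ne',
      Real.log_mul (hr i).ne' (hc j).ne', Real.log_exp, Real.log_exp] at h2
    have h3 : α i + β j + L - K ≤
        Real.exp (α i) * A i j * Real.exp (β j) * N / (r i * c j) - 1 := by linarith
    refine (mul_le_mul_of_nonneg_left h3 (hc j).le).trans_eq ?_
    have := (hc j).ne'
    have := (hr i).ne'
    field_simp
  have hsum := Finset.sum_le_sum fun j (_ : j ∈ Finset.univ) => key j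
  rw [Finset.sum_sub_distrib, ← Finset.mul_sum, hrow i, hcN, div_mul_cancel₀ _ (hr i).ne'] at hsum
  have e : ∑ j, c j * (α i + β j + L - K) = N * α i + ∑ j, c j * β j + N * L - N * K := by
    rw [← hcN]
    simp only [Finset.sum_mul, ← Finset.sum_add_distrib, ← Finset.sum_sub_distrib]
    exact Finset.sum_congr rfl fun j _ => by ring
  linarith

/-- Two rows divided by their margins differ entrywise by a factor of at most `exp (2 * K)`. The row
equation makes `exp (-α i)` a combination of such normalized entries with weights `exp (β j)` common
to all rows. -/
lemma potential_sub_le {A : Matrix (Fin m) (Fin n) ℝ} (hA : ∀ i j, 0 < A i j)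
    {r : Fin m → ℝ} {c : Fin n → ℝ} (hr : ∀ i, 0 < r i) {N L K : ℝ}
    (hK : ∀ i j, |Real.log (A i j) + Real.log N - Real.log (r i) - Real.log (c j) - L| ≤ K)
    {α : Fin m → ℝ} {β : Fin n → ℝ}
    (hrow : ∀ i, ∑ j, Real.exp (α i) * A i j * Real.exp (β j) = r i) (i k : Fin m) :
    α k - α i ≤ 2 * K := by
  have hS : ∀ i, ∑ j, A i j * Real.exp (β j) = r i * Real.exp (-α i) := by
    intro i
    rw [← hrow i, Finset.sum_mul]
    refine Finset.sum_congr rfl fun j _ => ?_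
    rw [Real.exp_neg]
    have := (Real.exp_pos (α i)).ne'
    field_simp
  have h1 : ∀ j, A i j * r k ≤ Real.exp (2 * K) * (A k j * r i) := by
    intro j
    have hl := hA i j
    have hk := hA k j
    have := hr i
    have := hr k
    rw [← Real.log_le_log_iff (by positivity) (by positivity), Real.log_mul hl.ne' (hr k).ne',
      Real.log_mul (Real.exp_pos _).ne' (by positivity), Real.log_exp,
      Real.log_mul hk.ne' (hr i).ne']
    have h2 := (abs_le.1 (hK i j)).2
    have h3 := (abs_le.1 (hK k j)).1
    linarith
  have h2 : r k * (r i * Real.exp (-α i)) ≤ Real.exp (2 * K) * r i * (r k * Real.exp (-α k)) := by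
    rw [← hS, ← hS, Finset.mul_sum, Finset.mul_sum]
    refine Finset.sum_le_sum fun j _ => ?_
    have := mul_le_mul_of_nonneg_right (h1 j) (Real.exp_pos (β j)).le
    linarith
  have h3 : r i * r k * Real.exp (-α i) ≤ r i * r k * Real.exp (2 * K + -α k) := by
    rw [Real.exp_add]
    linarith
  have h4 := le_of_mul_le_mul_left h3 (mul_pos (hr i) (hr k))
  rw [Real.exp_le_exp] at h4
  linarith

/-- Two-sided bounds for the sum of the potentials of a positive matrix under a bound on the
logarithmic cost. -/
lemma potential_add_bounds {A : Matrix (Fin m) (Fin n) ℝ} (hA : ∀ i j, 0 < A i j)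
    {r : Fin m → ℝ} {c : Fin n → ℝ} (hr : ∀ i, 0 < r i) (hc : ∀ j, 0 < c j) {N L K : ℝ}
    (hN : 0 < N) (hrN : ∑ i, r i = N) (hcN : ∑ j, c j = N)
    (hL : ∑ i, ∑ j, A i j = N * Real.exp L)
    (hK : ∀ i j, |Real.log (A i j) + Real.log N - Real.log (r i) - Real.log (c j) - L| ≤ K)
    {α : Fin m → ℝ} {β : Fin n → ℝ} (hαβ : IsSchrodingerPotential A r c α β)
    (i : Fin m) (j : Fin n) : -(4 * K) - L ≤ α i + β j ∧ α i + β j ≤ 2 * K - L := by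
  obtain ⟨hrow, hcol⟩ := (isSchrodingerPotential_iff fun i j => (hA i j).le).1 hαβ
  have hcol' : ∀ j, ∑ i, Real.exp (β j) * A.transpose j i * Real.exp (α i) = c j := by
    intro j
    rw [← hcol j]
    exact Finset.sum_congr rfl fun i _ => by rw [Matrix.transpose_apply]; ring
  have hK' : ∀ j i, |Real.log (A.transpose j i) + Real.log N - Real.log (c j) - Real.log (r i) - L|
      ≤ K := by
    intro j i
    rw [Matrix.transpose_apply, sub_right_comm _ (Real.log (c j))]
    exact hK i j
  have hA' : ∀ j i, 0 < A.transpose j i := fun j i => hA i j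
  have e : ∑ i, r i * α i + ∑ j, c j * β j + N * L =
      ∑ i, ∑ j, (Real.exp (α i) * A i j * Real.exp (β j)) * (α i + β j + L) := by
    simp only [mul_add, Finset.sum_add_distrib]
    congr 1
    · congr 1
      · exact Finset.sum_congr rfl fun i _ => by rw [← Finset.sum_mul, hrow]
      · rw [Finset.sum_comm]
        exact Finset.sum_congr rfl fun j _ => by rw [← Finset.sum_mul, hcol]
    · rw [← hrN, Finset.sum_mul]
      exact Finset.sum_congr rfl fun i _ => by rw [← Finset.sum_mul, hrow]
  -- By `e` this is the relative entropy of the scaled matrix with respect to `A * exp (-L)`. Both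
  -- have mass `N`, so it is nonnegative.
  have hkl : 0 ≤ ∑ i, r i * α i + ∑ j, c j * β j + N * L := by
    have key : ∀ i j, (Real.exp (α i) * A i j * Real.exp (β j)) - A i j * Real.exp (-L) ≤
        (Real.exp (α i) * A i j * Real.exp (β j)) * (α i + β j + L) := by
      intro i j
      have h1 := Real.add_one_le_exp (-(α i + β j + L))
      have h2 : 0 < Real.exp (α i) * A i j * Real.exp (β j) := by
        have := hA i j
        positivity
      have h3 : A i j * Real.exp (-L) = (Real.exp (α i) * A i j * Real.exp (β j)) *
          Real.exp (-(α i + β j + L)) := by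
        have : Real.exp (-(α i + β j + L)) = (Real.exp (α i))⁻¹ * (Real.exp (β j))⁻¹ *
            Real.exp (-L) := by
          rw [← Real.exp_neg, ← Real.exp_neg, ← Real.exp_add, ← Real.exp_add]
          congr 1
          ring
        rw [this]
        have := (Real.exp_pos (α i)).ne'
        have := (Real.exp_pos (β j)).ne'
        field_simp
      rw [h3]
      nlinarith
    have hsum := Finset.sum_le_sum fun i (_ : i ∈ Finset.univ) =>
      Finset.sum_le_sum fun j (_ : j ∈ Finset.univ) => key i j
    simp only [Finset.sum_sub_distrib, hrow, ← Finset.sum_mul, hrN, hL] at hsum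
    rw [e]
    refine le_trans (le_of_eq ?_) hsum
    rw [mul_assoc, ← Real.exp_add]
    simp
  have h1 := potential_mul_add_le hA hr hc hN hcN hK hrow
  have h2 := potential_mul_add_le hA' hc hr hN hrN hK' hcol'
  constructor
  -- A nonnegative average has a nonnegative term; moving from `(k, l)` to `(i, j)` costs an
  -- oscillation of `2 * K` in each potential.
  · have hex : ∃ k l, 0 ≤ α k + β l + L := by
      by_contra! hneg
      have : ∑ i, ∑ j, (Real.exp (α i) * A i j * Real.exp (β j)) * (α i + β j + L) < 0 := by
        refine Finset.sum_neg (fun i _ => Finset.sum_neg (fun j _ => ?_) ⟨j, Finset.mem_univ _⟩)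
          ⟨i, Finset.mem_univ _⟩
        refine mul_neg_of_pos_of_neg ?_ (hneg i j)
        have := hA i j
        positivity
      linarith
    obtain ⟨k, l, hkl⟩ := hex
    have h3 := potential_sub_le hA hr hK hrow i k
    have h4 := potential_sub_le hA' hc hK' hcol' j l
    linarith
  · have h3 := h1 i
    have h4 := h2 j
    -- Adding the row and column bounds produces the entropy of `hkl` plus `N * (α i + β j + L)`;
    -- the entropy is dropped.
    have : N * (α i + β j) ≤ N * (2 * K - L) := by linarith
    exact le_of_mul_le_mul_left this hN

/-! ### Elementary facts on smooth margins and matrix entries. -/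

section Margins

variable {δ : ℝ} {r : Fin m → ℝ} {c : Fin n → ℝ}

lemma IsSmoothMargin.m_pos (h : IsSmoothMargin δ r c) : 0 < m := by
  by_contra! hm
  obtain rfl : m = 0 := by omega
  simpa using h.total_pos

lemma IsSmoothMargin.n_pos (h : IsSmoothMargin δ r c) : 0 < n := by
  by_contra! hn
  obtain rfl : n = 0 := by omega
  have := h.total_pos
  rw [h.sum_eq] at this
  simp at this

lemma IsSmoothMargin.row_pos (h : IsSmoothMargin δ r c) (i : Fin m) : 0 < r i := by
  have h1 := h.total_pos
  have h2 := h.delta_pos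
  have h3 : (0 : ℝ) < m := by exact_mod_cast h.m_pos
  exact lt_of_lt_of_le (by positivity) (h.row_bounds i).1

lemma IsSmoothMargin.col_pos (h : IsSmoothMargin δ r c) (j : Fin n) : 0 < c j := by
  have h1 := h.total_pos
  have h2 := h.delta_pos
  have h3 : (0 : ℝ) < n := by exact_mod_cast h.n_pos
  exact lt_of_lt_of_le (by positivity) (h.col_bounds j).1

lemma IsSmoothMargin.delta_le_one (h : IsSmoothMargin δ r c) : δ ≤ 1 := by
  have h1 := h.total_pos
  have h3 : (0 : ℝ) < m := by exact_mod_cast h.m_pos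
  have h4 := Finset.sum_le_sum fun i (_ : i ∈ Finset.univ) => (h.row_bounds i).1
  rw [Finset.sum_const, Finset.card_univ, Fintype.card_fin, nsmul_eq_mul,
    mul_div_cancel₀ _ h3.ne'] at h4
  exact le_of_mul_le_mul_right (by linarith) h1

end Margins

section Entries

variable {A : Matrix (Fin m) (Fin n) ℝ}

lemma minEntry_le (A : Matrix (Fin m) (Fin n) ℝ) (i : Fin m) (j : Fin n) : minEntry A ≤ A i j :=
  (ciInf_le (Set.finite_range _).bddBelow i).trans (ciInf_le (Set.finite_range _).bddBelow j)

lemma le_maxEntry (A : Matrix (Fin m) (Fin n) ℝ) (i : Fin m) (j : Fin n) : A i j ≤ maxEntry A :=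
  (le_ciSup (f := fun j => A i j) (Set.finite_range _).bddAbove j).trans
    (le_ciSup (f := fun i => ⨆ j, A i j) (Set.finite_range _).bddAbove i)

lemma minEntry_pos (hm : 0 < m) (hn : 0 < n) (hA : ∀ i j, 0 < A i j) : 0 < minEntry A := by
  have : Nonempty (Fin m) := ⟨⟨0, hm⟩⟩
  have : Nonempty (Fin n) := ⟨⟨0, hn⟩⟩
  obtain ⟨i, hi⟩ := exists_eq_ciInf_of_finite (f := fun i => ⨅ j, A i j)
  obtain ⟨j, hj⟩ := exists_eq_ciInf_of_finite (f := fun j => A i j)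
  have : minEntry A = A i j := by rw [minEntry, ← hi, ← hj]
  rw [this]
  exact hA i j

lemma l1Norm_eq_sum (hA : ∀ i j, 0 < A i j) : l1Norm A = ∑ i, ∑ j, A i j := by
  simp only [l1Norm, abs_of_pos (hA _ _)]

lemma mul_minEntry_le_l1Norm (hA : ∀ i j, 0 < A i j) : m * n * minEntry A ≤ l1Norm A := by
  rw [l1Norm_eq_sum hA]
  calc m * n * minEntry A = ∑ _i : Fin m, ∑ _j : Fin n, minEntry A := by
        simp [mul_assoc]
    _ ≤ _ := Finset.sum_le_sum fun i _ => Finset.sum_le_sum fun j _ => minEntry_le A i j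

lemma l1Norm_pos (hm : 0 < m) (hn : 0 < n) (hA : ∀ i j, 0 < A i j) : 0 < l1Norm A := by
  have h1 := minEntry_pos hm hn hA
  have h2 : (0 : ℝ) < m := by exact_mod_cast hm
  have h3 : (0 : ℝ) < n := by exact_mod_cast hn
  exact lt_of_lt_of_le (by positivity) (mul_minEntry_le_l1Norm hA)

end Entries

/-! ### From bounded cost and row overlap to deterministic stability. -/

/-- Bounds for the scaling factors of a positive matrix of bounded cost. -/
lemma BoundedCost.exp_potential_bounds {Λ : Matrix (Fin m) (Fin n) ℝ} {r : Fin m → ℝ}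
    {c : Fin n → ℝ} {δ K : ℝ} (hK : BoundedCost Λ r c K) (h : IsSmoothMargin δ r c)
    (hΛ : ∀ i j, 0 < Λ i j) {α : Fin m → ℝ} {β : Fin n → ℝ}
    (hαβ : IsSchrodingerPotential Λ r c α β) (i : Fin m) (j : Fin n) :
    Real.exp (-(4 * K)) * ((∑ k, r k) / l1Norm Λ) ≤ Real.exp (α i) * Real.exp (β j) ∧
      Real.exp (α i) * Real.exp (β j) ≤ Real.exp (2 * K) * ((∑ k, r k) / l1Norm Λ) := by
  have hN := h.total_pos
  have hS := l1Norm_pos h.m_pos h.n_pos hΛ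
  set N := ∑ k, r k with hNdef
  set S := l1Norm Λ with hSdef
  set L := Real.log (S / N) with hL
  have hL' : Real.exp (-L) = N / S := by
    rw [hL, ← Real.log_inv, inv_div, Real.exp_log (by positivity)]
  have hb := potential_add_bounds (L := L) hΛ h.row_pos h.col_pos hN rfl h.sum_eq.symm (by
      rw [← l1Norm_eq_sum hΛ, ← hSdef, hL, Real.exp_log (by positivity)]
      field_simp) (K := K) (by
      intro i j
      have h1 := hK.2 i j
      rw [← abs_neg]
      convert h1 using 2
      rw [hL, Real.log_div hS.ne' hN.ne', Real.log_div
        (mul_pos (mul_pos (h.row_pos i) (h.col_pos j)) hS).ne' (mul_pos (hΛ i j) (by positivity)).ne',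
        Real.log_mul (mul_pos (h.row_pos i) (h.col_pos j)).ne' hS.ne',
        Real.log_mul (h.row_pos i).ne' (h.col_pos j).ne',
        Real.log_mul (hΛ i j).ne' (by positivity), Real.log_pow]
      push_cast
      ring) hαβ i j
  rw [← hL', ← Real.exp_add, ← Real.exp_add, ← Real.exp_add, Real.exp_le_exp, Real.exp_le_exp]
  exact hb

/-- Overlap of the rows of a nearly scaled matrix, from the overlap of the rows of the
unscaled one. -/
lemma HasApproxMargin.le_rowOverlap {X A Λ : Matrix (Fin m) (Fin n) ℝ} {r : Fin m → ℝ}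
    {c : Fin n → ℝ} {δ K ε : ℝ} (h : IsSmoothMargin δ r c) (hΛ : ∀ i j, 0 < Λ i j) (hK0 : 0 ≤ K)
    (hX : ∀ i j, 0 ≤ X i j) (hA : HasApproxMargin A r c ε)
    (hXA : ∀ i j, Real.exp (-(4 * K)) * ((∑ k, r k) / l1Norm Λ) * X i j ≤ A i j)
    (hpair : ∀ i k, i ≠ k → n * minEntry Λ ^ 2 / 2 ≤ ∑ j, X i j * X k j) (i k : Fin m) :
    8 / (m * (CStar Λ δ K - 1)) ≤ rowOverlap A i k := by
  have hm : (0 : ℝ) < m := by exact_mod_cast h.m_pos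
  have hn : (0 : ℝ) < n := by exact_mod_cast h.n_pos
  have hN := h.total_pos
  have hδ := h.delta_pos
  have hδ1 := h.delta_le_one
  have hS := l1Norm_pos h.m_pos h.n_pos hΛ
  have hlam := minEntry_pos h.m_pos h.n_pos hΛ
  have hlamS := mul_minEntry_le_l1Norm hΛ
  have hε0 := hA.err_nonneg
  have hε1 := hA.err_le
  set N := ∑ k, r k
  set S := l1Norm Λ
  set l := minEntry Λ
  have he8 : Real.exp (8 * K) = Real.exp (4 * K) ^ 2 := by
    rw [← Real.exp_nat_mul]
    congr 1
    push_cast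
    ring
  -- The factor `4 / 9 = 8 / 18` leaves room for the margin errors of `1 / 50`: the off-diagonal
  -- case needs at most `(50 / 51) ^ 2 / 2`, the diagonal one at most `49 / 51`.
  have hp : 8 / (m * (CStar Λ δ K - 1)) =
      4 / 9 * (δ ^ 2 * l ^ 2 * m * n ^ 2 / (Real.exp (4 * K) ^ 2 * S ^ 2)) := by
    rw [CStar, add_sub_cancel_left, he8]
    change 8 / (m * (18 * Real.exp (4 * K) ^ 2 * S ^ 2 / (δ ^ 2 * l ^ 2 * m ^ 2 * n ^ 2))) = _
    field_simp
    norm_num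
  rw [hp]
  have hE1 : 1 ≤ Real.exp (4 * K) := Real.one_le_exp (by linarith)
  rw [Real.exp_neg] at hXA
  set E := Real.exp (4 * K)
  have hE0 : 0 < E := by linarith
  have hrow : ∀ i, rowSum A i ≤ 51 / 50 * (N / (δ * m)) := fun i =>
    (hA.row_le i).trans (by
      have := h.row_pos i
      exact mul_le_mul (by linarith) (h.row_bounds i).2 this.le (by norm_num))
  have hcol : ∀ j, colSum A j ≤ 51 / 50 * (N / (δ * n)) := fun j =>
    (hA.col_le j).trans (by
      have := h.col_pos j
      exact mul_le_mul (by linarith) (h.col_bounds j).2 this.le (by norm_num))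
  rcases eq_or_ne i k with rfl | hik
  -- The inner product bound concerns distinct rows only. The overlap of a row with itself is
  -- bounded by Cauchy–Schwarz, using just the margins.
  · have hCpos := hA.colSum_pos
    have hT0 : 0 < ∑ j, colSum A j := by
      have : Nonempty (Fin n) := ⟨⟨0, h.n_pos⟩⟩
      exact Finset.sum_pos (fun j _ => hCpos j) Finset.univ_nonempty
    have h1 : rowSum A i / ∑ j, colSum A j ≤ rowOverlap A i i := by
      have h2 := Finset.sum_sq_le_sum_mul_sum_of_sq_le_mul Finset.univ (r := fun j => A i j)
        (f := fun j => A i j * A i j / colSum A j) (g := fun j => colSum A j)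
        (fun j _ => div_nonneg (mul_self_nonneg _) (hCpos j).le) (fun j _ => (hCpos j).le)
        (fun j _ => by
          rw [div_mul_cancel₀ _ (hCpos j).ne', sq])
      have e : rowOverlap A i i = (∑ j, A i j * A i j / colSum A j) / rowSum A i := by
        rw [rowOverlap, Finset.sum_div]
        refine Finset.sum_congr rfl fun j _ => ?_
        rw [div_div, mul_comm (rowSum A i)]
      rw [e, div_le_div_iff₀ hT0 (hA.rowSum_pos i), ← sq]
      exact h2
    refine le_trans ?_ h1
    have hT : ∑ j, colSum A j ≤ 51 / 50 * N := by
      have : N = ∑ j, c j := h.sum_eq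
      rw [this, Finset.mul_sum]
      refine Finset.sum_le_sum fun j _ => (hA.col_le j).trans ?_
      have := h.col_pos j
      gcongr
      linarith
    have hR : 49 / 50 * (δ * N / m) ≤ rowSum A i := by
      refine le_trans ?_ (hA.le_row i)
      have h3 := (h.row_bounds i).1
      have h4 : 0 ≤ δ * N / m := by positivity
      exact mul_le_mul (by linarith) h3 h4 (by linarith)
    have hfrac : δ ^ 2 * l ^ 2 * m * n ^ 2 / (E ^ 2 * S ^ 2) ≤ δ / m := by
      rw [div_le_div_iff₀ (by positivity) hm]
      have h5 : (m * n * l) ^ 2 ≤ S ^ 2 := by gcongr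
      have h6 : (1 : ℝ) ≤ E ^ 2 := one_le_pow₀ hE1
      calc δ ^ 2 * l ^ 2 * m * n ^ 2 * m = δ * (δ * (m * n * l) ^ 2) := by ring
        _ ≤ δ * (1 * S ^ 2) := by gcongr
        _ ≤ δ * (E ^ 2 * S ^ 2) := by gcongr
    calc 4 / 9 * (δ ^ 2 * l ^ 2 * m * n ^ 2 / (E ^ 2 * S ^ 2)) ≤ 4 / 9 * (δ / m) := by gcongr
      _ ≤ 49 / 51 * (δ / m) := by
        exact mul_le_mul_of_nonneg_right (by norm_num) (by positivity)
      _ = 49 / 50 * (δ * N / m) / (51 / 50 * N) := by field_simp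
      _ ≤ _ := by
        have := hA.rowSum_pos i
        gcongr
  · have hterm : ∀ j, (E⁻¹ * (N / S)) ^ 2 / (51 / 50 * (N / (δ * m)) * (51 / 50 * (N / (δ * n)))) *
        (X i j * X k j) ≤ A i j * A k j / (rowSum A i * colSum A j) := by
      intro j
      rw [div_mul_eq_mul_div]
      have h1 : (E⁻¹ * (N / S)) ^ 2 * (X i j * X k j) ≤ A i j * A k j := by
        have := mul_le_mul (hXA i j) (hXA k j) (mul_nonneg (by positivity) (hX k j)) (hA.nonneg i j)
        linarith
      exact div_le_div₀ (mul_nonneg (hA.nonneg _ _) (hA.nonneg _ _)) h1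
        (mul_pos (hA.rowSum_pos i) (hA.colSum_pos j))
        (mul_le_mul (hrow i) (hcol j) (hA.colSum_pos j).le (by positivity))
    have hsum := Finset.sum_le_sum fun j (_ : j ∈ Finset.univ) => hterm j
    rw [← Finset.mul_sum] at hsum
    refine le_trans ?_ hsum
    calc 4 / 9 * (δ ^ 2 * l ^ 2 * m * n ^ 2 / (E ^ 2 * S ^ 2))
        ≤ 1250 / 2601 * (δ ^ 2 * l ^ 2 * m * n ^ 2 / (E ^ 2 * S ^ 2)) := by
          exact mul_le_mul_of_nonneg_right (by norm_num) (by positivity)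
      _ = (E⁻¹ * (N / S)) ^ 2 / (51 / 50 * (N / (δ * m)) * (51 / 50 * (N / (δ * n)))) *
        (n * l ^ 2 / 2) := by
          field_simp
          norm_num
      _ ≤ _ := by
          gcongr
          exact hpair i k hik

/-- Deterministic stability of Schrödinger potentials: nearly correct margins after scaling by
the potentials of `Λ`, together with overlapping rows, force scalability and closeness. -/
lemma potentials_stable {X Λ : Matrix (Fin m) (Fin n) ℝ} {r : Fin m → ℝ} {c : Fin n → ℝ}
    {δ K ε : ℝ} (h : IsSmoothMargin δ r c) (hΛ : ∀ i j, 0 < Λ i j) (hK : BoundedCost Λ r c K)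
    {α : Fin m → ℝ} {β : Fin n → ℝ} (hαβ : IsSchrodingerPotential Λ r c α β)
    (hε0 : 0 ≤ ε) (hε : ε ≤ 1 / (50 * CStar Λ δ K ^ 2)) (hX : ∀ i j, 0 ≤ X i j)
    (hrow : ∀ i, |(∑ j, Real.exp (α i) * Real.exp (β j) * X i j) - r i| ≤ ε * r i)
    (hcol : ∀ j, |(∑ i, Real.exp (α i) * Real.exp (β j) * X i j) - c j| ≤ ε * c j)
    (hpair : ∀ i k, i ≠ k → n * minEntry Λ ^ 2 / 2 ≤ ∑ j, X i j * X k j) :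
    X ∈ scalable r c ∧
    ∀ (αX : Fin m → ℝ) (βX : Fin n → ℝ), IsSchrodingerPotential X r c αX βX →
      ∃ t : ℝ, max ‖fun i => αX i + t - α i‖ ‖fun j => βX j - t - β j‖ ≤
        4 * CStar Λ δ K * ε := by
  have hm : (0 : ℝ) < m := by exact_mod_cast h.m_pos
  have hn : (0 : ℝ) < n := by exact_mod_cast h.n_pos
  have hδ := h.delta_pos
  have hS := l1Norm_pos h.m_pos h.n_pos hΛ
  have hlam := minEntry_pos h.m_pos h.n_pos hΛ
  set C := CStar Λ δ K with hCdef
  have hC : 0 < C - 1 := by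
    rw [hCdef, CStar, add_sub_cancel_left]
    positivity
  have hC2 : 50 * C ^ 2 * ε ≤ 1 := by
    rw [le_div_iff₀ (by nlinarith)] at hε
    linarith
  set A : Matrix (Fin m) (Fin n) ℝ := fun i j => Real.exp (α i) * Real.exp (β j) * X i j with hAdef
  have hA : HasApproxMargin A r c ε :=
    { nonneg := fun i j => mul_nonneg (by positivity) (hX i j)
      row_pos := h.row_pos
      col_pos := h.col_pos
      err_nonneg := hε0
      err_le := by nlinarith [mul_nonneg hε0 hC.le, mul_nonneg hε0 (mul_pos hC hC).le]
      row := hrow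
      col := hcol }
  have hov := hA.le_rowOverlap h hΛ hK.1 hX
    (fun i j => mul_le_mul_of_nonneg_right (hK.exp_potential_bounds h hΛ hαβ i j).1 (hX i j)) hpair
  rw [← hCdef] at hov
  have hp0 : 0 < 8 / (m * (C - 1)) := by positivity
  have hmp : m * (8 / (m * (C - 1))) = 8 / (C - 1) := by field_simp
  have hεp : 12 * ε ≤ m * (8 / (m * (C - 1))) := by
    rw [hmp, le_div_iff₀ hC]
    nlinarith [mul_nonneg hε0 hC.le, mul_nonneg hε0 (mul_pos hC hC).le]
  have hAX : ∀ (α' : Fin m → ℝ) (β' : Fin n → ℝ), IsSchrodingerPotential A r c α' β' ↔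
      IsSchrodingerPotential X r c (fun i => α' i + α i) (fun j => β' j + β j) := by
    intro α' β'
    rw [isSchrodingerPotential_iff hA.nonneg, isSchrodingerPotential_iff hX]
    have e : ∀ i j, Real.exp (α' i) * A i j * Real.exp (β' j) =
        Real.exp (α' i + α i) * X i j * Real.exp (β' j + β j) := by
      intro i j
      rw [Real.exp_add, Real.exp_add]
      simp only [hAdef]
      ring
    simp only [e]
  constructor
  · obtain ⟨α', β', hp⟩ := hA.exists_isSchrodingerPotential h.m_pos h.sum_eq hov hp0 hεp
    exact ((hAX α' β').1 hp).mem_scalable hX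
  · intro αX βX hp
    have hp' : IsSchrodingerPotential A r c (fun i => αX i - α i) (fun j => βX j - β j) := by
      rw [hAX]
      simpa only [sub_add_cancel] using hp
    obtain ⟨t, h1, h2⟩ := hA.exists_shift_abs_le h.m_pos hov hp0 hεp hp'
    rw [hmp] at h1 h2
    -- With `m * p = 8 / (C - 1)` the two errors are at most `3 / 4 * (C - 1) * ε + 2 * ε`, within
    -- `4 * C * ε` because `C > 1`.
    have e : 6 * ε / (8 / (C - 1)) = 3 / 4 * (C - 1) * ε := by
      field_simp
      ring
    rw [e] at h1 h2
    have hη : 0 ≤ (C - 1) * ε := by positivity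
    refine ⟨t, max_le ?_ ?_⟩
    · rw [pi_norm_le_iff_of_nonneg (by nlinarith)]
      intro i
      rw [Real.norm_eq_abs, add_sub_right_comm]
      exact (h1 i).trans (by nlinarith)
    · rw [pi_norm_le_iff_of_nonneg (by nlinarith)]
      intro j
      rw [Real.norm_eq_abs, sub_right_comm]
      exact (h2 j).trans (by nlinarith)

/-! ### The random matrix: margin errors, row alignment and the union bound. -/

section Probability

variable {Ω : Type*} [MeasurableSpace Ω] {P : Measure Ω} [IsProbabilityMeasure P]
  {X : Ω → Matrix (Fin m) (Fin n) ℝ} {Λ : Matrix (Fin m) (Fin n) ℝ} {σ R : ℝ}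

lemma IsSubexponential.bernsteinMoments (h : IsSubexponential P X Λ σ R) (i : Fin m) (j : Fin n) :
    BernsteinMoments P (fun ω => X ω i j - Λ i j) σ R where
  measurable := (h.measurable i j).sub_const _
  integrable := (h.integrable i j).sub (integrable_const _)
  mean := by
    rw [integral_sub (h.integrable i j) (integrable_const _), h.mean]
    simp
  integrable_pow q hq := (h.moment i j q hq).1
  moment q hq := (h.moment i j q hq).2

/-- Bernstein's inequality for weighted sums of distinct entries. -/
lemma IsSubexponential.bernstein_entries (h : IsSubexponential P X Λ σ R) {ι : Type*} [Fintype ι]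
    {e : ι → Fin m × Fin n} (he : Function.Injective e) {a : ι → ℝ} {B M τ : ℝ} (hB : 0 < B)
    (ha : ∀ k, |a k| ≤ B) (hM : (Fintype.card ι : ℝ) ≤ M) (hM0 : 0 < M) (hτ : 0 < τ) :
    P.real {ω | B * (σ * Real.sqrt (2 * M * τ) + 2 * R * τ) ≤
      |∑ k, a k * (X ω (e k).1 (e k).2 - Λ (e k).1 (e k).2)|} ≤ 2 * Real.exp (-τ) := by
  have hind := (h.indep.precomp he).comp (fun k x => a k * (x - Λ (e k).1 (e k).2))
    (fun k => (measurable_id.sub_const _).const_mul _)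
  have := bernstein hind (mul_pos hB h.sigma_pos) (mul_pos hB h.R_pos)
    (fun k => (h.bernsteinMoments (e k).1 (e k).2).const_mul (ha k)) hM hM0 hτ
  have hthr : B * (σ * Real.sqrt (2 * M * τ) + 2 * R * τ) =
      B * σ * Real.sqrt (2 * M * τ) + 2 * (B * R) * τ := by ring
  rw [hthr]
  exact this

lemma IsSubexponential.integrable_sq (h : IsSubexponential P X Λ σ R) (i : Fin m) (j : Fin n) :
    Integrable (fun ω => X ω i j ^ 2) P := by
  have h1 := (h.moment i j 2 le_rfl).1
  simp only [sq_abs] at h1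
  have h2 := (h1.add ((h.integrable i j).const_mul (2 * Λ i j))).sub
    (integrable_const (μ := P) (Λ i j ^ 2))
  refine h2.congr (.of_forall fun ω => ?_)
  simp only [Pi.add_apply, Pi.sub_apply]
  ring

lemma IsSubexponential.integral_sq_le (h : IsSubexponential P X Λ σ R) (i : Fin m) (j : Fin n) :
    ∫ ω, X ω i j ^ 2 ∂P ≤ σ ^ 2 + Λ i j ^ 2 := by
  have h1 := (h.moment i j 2 le_rfl).2
  simp only [sq_abs, Nat.factorial_two, Nat.sub_self, pow_zero] at h1
  have h2 : ∫ ω, (X ω i j - Λ i j) ^ 2 ∂P = ∫ ω, X ω i j ^ 2 ∂P - Λ i j ^ 2 := by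
    have e : ∀ ω, (X ω i j - Λ i j) ^ 2 = X ω i j ^ 2 - (2 * Λ i j * X ω i j - Λ i j ^ 2) :=
      fun ω => by ring
    simp only [e]
    have h3 : Integrable (fun ω => 2 * Λ i j * X ω i j) P := (h.integrable i j).const_mul _
    have h4 : Integrable (fun ω => 2 * Λ i j * X ω i j - Λ i j ^ 2) P :=
      h3.sub (integrable_const _)
    rw [integral_sub (h.integrable_sq i j) h4, integral_sub h3 (integrable_const _),
      integral_const_mul, h.mean]
    simp only [integral_const, probReal_univ, one_smul]
    ring
  rw [h2] at h1
  push_cast at h1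
  linarith

/-- Two distinct rows overlap with high probability. -/
lemma IsSubexponential.row_alignment (h : IsSubexponential P X Λ σ R) (hm : 0 < m) (hn : 0 < n)
    {i k : Fin m} (hik : i ≠ k) :
    P.real {ω | ∑ j, X ω i j * X ω k j ≤ n * minEntry Λ ^ 2 / 2} ≤
      Real.exp (-(1 / 8 * alignmentRate Λ σ R)) := by
  have hΛ := h.mean_pos
  have hl := minEntry_pos hm hn hΛ
  have hσ := h.sigma_pos
  have hR := h.R_pos
  have hmax : 0 < maxEntry Λ := (hΛ ⟨0, hm⟩ ⟨0, hn⟩).trans_le (le_maxEntry Λ _ _)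
  set T := σ + R + maxEntry Λ with hT
  have hT0 : 0 < T := by positivity
  have hind : ∀ j, IndepFun (fun ω => X ω i j) (fun ω => X ω k j) P := fun j =>
    h.indep.indepFun (i := (i, j)) (j := (k, j)) (by simp [hik])
  have hind2 : ∀ j, IndepFun (fun ω => X ω i j ^ 2) (fun ω => X ω k j ^ 2) P := fun j =>
    (hind j).comp (φ := fun x => x ^ 2) (ψ := fun x => x ^ 2) (by fun_prop) (by fun_prop)
  have hsq : ∀ i j, ∫ ω, X ω i j ^ 2 ∂P ≤ T ^ 2 := fun i j => by
    refine (h.integral_sq_le i j).trans ?_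
    have h1 := le_maxEntry Λ i j
    have h2 := hΛ i j
    have h3 : Λ i j ^ 2 ≤ maxEntry Λ ^ 2 := by gcongr
    rw [hT]
    nlinarith [mul_pos hσ hmax, mul_pos hR hmax, mul_pos hσ hR]
  have hmgf := mgf_sum_row_mul_row (X := fun i j ω => X ω i j) h.indep h.measurable i k Finset.univ
  have key := lower_tail_of_mgf_sum_eq (Z := fun j ω => X ω i j * X ω k j) (μ := minEntry Λ ^ 2)
    (v := T ^ 4) hmgf (fun j => (h.measurable i j).mul (h.measurable k j))
    (fun j => by
      filter_upwards [h.nonneg i j, h.nonneg k j] with ω h1 h2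
      exact mul_nonneg h1 h2)
    (fun j => (hind j).integrable_mul (h.integrable i j) (h.integrable k j))
    (fun j => by
      simp only [mul_pow]
      exact (hind2 j).integrable_mul (h.integrable_sq i j) (h.integrable_sq k j))
    (by positivity) (by positivity)
    (fun j => by
      rw [(hind j).integral_fun_mul_eq_mul_integral (h.measurable i j).aestronglyMeasurable
        (h.measurable k j).aestronglyMeasurable, h.mean, h.mean, sq]
      exact mul_le_mul (minEntry_le Λ i j) (minEntry_le Λ k j) hl.le (hΛ i j).le)
    (fun j => by
      simp only [mul_pow]
      rw [(hind2 j).integral_fun_mul_eq_mul_integral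
        ((h.measurable i j).pow_const 2).aestronglyMeasurable
        ((h.measurable k j).pow_const 2).aestronglyMeasurable]
      calc _ ≤ T ^ 2 * T ^ 2 := mul_le_mul (hsq i j) (hsq k j)
            (integral_nonneg fun ω => sq_nonneg _) (by positivity)
        _ = T ^ 4 := by ring)
  rw [Fintype.card_fin] at key
  refine key.trans (Real.exp_le_exp.2 (neg_le_neg ?_))
  -- The terms of the inner product are nonnegative, so second moments already give a Gaussian lower
  -- tail of rate `n * minEntry Λ ^ 4 / (8 * T ^ 4)`; the first term of the minimum suffices. This
  -- is the source of the absolute constant `1 / 8`.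
  have h1 : alignmentRate Λ σ R ≤ n * (minEntry Λ ^ 4 / T ^ 4) := min_le_left _ _
  have h2 : n * (minEntry Λ ^ 2) ^ 2 / (8 * T ^ 4) = 1 / 8 * (n * (minEntry Λ ^ 4 / T ^ 4)) := by
    field_simp
  rw [h2]
  gcongr

lemma tau_pos {D : ℝ} (hm : 0 < m) (hD : 0 < D) : 0 < tau m n D := by
  have h1 : (1 : ℝ) ≤ (max m n : ℕ) := by
    exact_mod_cast hm.trans_le (le_max_left m n)
  have h2 := Real.log_nonneg h1
  have h3 : 0 < Real.log 4 := Real.log_pos (by norm_num)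
  rw [tau]
  positivity

/-- The union bound over all rows and columns, two tails each, has at most `4 * max m n` terms; the
`log 4` and the `+ 1` in `tau` absorb exactly this factor. -/
lemma exp_neg_tau {D : ℝ} (hm : 0 < m) :
    4 * ((max m n : ℕ) : ℝ) * Real.exp (-tau m n D) = ((max m n : ℕ) : ℝ) ^ (-D) := by
  have h1 : (0 : ℝ) < (max m n : ℕ) := by
    exact_mod_cast hm.trans_le (le_max_left m n)
  rw [tau, neg_add, Real.exp_add, Real.exp_neg (Real.log 4), Real.exp_log (by norm_num),
    Real.rpow_def_of_pos h1]
  have : Real.exp (-((D + 1) * Real.log (max m n : ℕ))) =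
      Real.exp (Real.log (max m n : ℕ) * -D) * ((max m n : ℕ) : ℝ)⁻¹ := by
    rw [← Real.exp_log (inv_pos.2 h1), ← Real.exp_add, Real.log_inv]
    congr 1
    ring
  rw [this]
  field_simp

/-- The margins of the random matrix, scaled by the potentials of its mean, are nearly correct and
its rows overlap, with high probability. -/
lemma IsSubexponential.le_measureReal_potentialEvent (h : IsSubexponential P X Λ σ R)
    {r : Fin m → ℝ} {c : Fin n → ℝ} {δ K D : ℝ} (hrc : IsSmoothMargin δ r c)
    (hK : BoundedCost Λ r c K) (hD : 0 < D)
    (hε : eps0 Λ δ K σ R D ≤ 1 / (50 * CStar Λ δ K ^ 2))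
    {α : Fin m → ℝ} {β : Fin n → ℝ} (hαβ : IsSchrodingerPotential Λ r c α β) :
    1 - ((max m n : ℕ) : ℝ) ^ (-D) - (m : ℝ) ^ 2 * Real.exp (-(1 / 8 * alignmentRate Λ σ R)) ≤
      P.real (potentialEvent X r c α β (4 * CStar Λ δ K * eps0 Λ δ K σ R D)) := by
  have hΛ := h.mean_pos
  have hm0 := hrc.m_pos
  have hn0 := hrc.n_pos
  have hm : (0 : ℝ) < m := by exact_mod_cast hm0
  have hn : (0 : ℝ) < n := by exact_mod_cast hn0
  have hδ := hrc.delta_pos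
  have hS := l1Norm_pos hm0 hn0 hΛ
  have hσ := h.sigma_pos
  have hR := h.R_pos
  have hτ : 0 < tau m n D := tau_pos hm0 hD
  have hmM : (m : ℝ) ≤ (max m n : ℕ) := by exact_mod_cast le_max_left m n
  have hnM : (n : ℝ) ≤ (max m n : ℕ) := by exact_mod_cast le_max_right m n
  have hMτ := exp_neg_tau (n := n) (D := D) hm0
  set ε := eps0 Λ δ K σ R D with hεdef
  rw [eps0] at hεdef
  set M : ℝ := ((max m n : ℕ) : ℝ)
  have hM : 0 < M := hm.trans_le hmM
  set τ := tau m n D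
  set b := Real.exp (2 * K) * M / (δ * l1Norm Λ) with hb
  have hb0 : 0 < b := by positivity
  have hε0 : 0 ≤ ε := by
    rw [hεdef]
    positivity
  have hfac := fun i j => (hK.exp_potential_bounds hrc hΛ hαβ i j).2
  -- Smoothness gives `N ≤ r i * m / δ`, so the weights are bounded relative to `r i` and the
  -- Bernstein threshold becomes exactly `eps0 * r i`.
  have hrowb : ∀ i j, |Real.exp (α i) * Real.exp (β j)| ≤ r i * b := by
    intro i j
    rw [abs_of_pos (by positivity)]
    refine (hfac i j).trans ?_
    have h1 := (hrc.row_bounds i).1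
    have h2 := hrc.row_pos i
    rw [div_le_iff₀ hm, ← le_div_iff₀' hδ] at h1
    calc _ ≤ Real.exp (2 * K) * (r i * m / δ / l1Norm Λ) := by gcongr
      _ ≤ Real.exp (2 * K) * (r i * M / δ / l1Norm Λ) := by gcongr
      _ = r i * b := by
        rw [hb]
        field_simp
  have hcolb : ∀ j i, |Real.exp (α i) * Real.exp (β j)| ≤ c j * b := by
    intro j i
    rw [abs_of_pos (by positivity)]
    refine (hfac i j).trans ?_
    have h1 := (hrc.col_bounds j).1
    have h2 := hrc.col_pos j
    rw [div_le_iff₀ hn, ← le_div_iff₀' hδ] at h1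
    calc _ ≤ Real.exp (2 * K) * (c j * n / δ / l1Norm Λ) := by gcongr
      _ ≤ Real.exp (2 * K) * (c j * M / δ / l1Norm Λ) := by gcongr
      _ = c j * b := by
        rw [hb]
        field_simp
  obtain ⟨hΛrow, hΛcol⟩ := (isSchrodingerPotential_iff fun i j => (hΛ i j).le).1 hαβ
  set Brow : Fin m → Set Ω := fun i => {ω | r i * b * (σ * Real.sqrt (2 * M * τ) + 2 * R * τ) ≤
    |∑ j, Real.exp (α i) * Real.exp (β j) * (X ω i j - Λ i j)|} with hBrow
  set Bcol : Fin n → Set Ω := fun j => {ω | c j * b * (σ * Real.sqrt (2 * M * τ) + 2 * R * τ) ≤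
    |∑ i, Real.exp (α i) * Real.exp (β j) * (X ω i j - Λ i j)|} with hBcol
  set Bpair : Fin m × Fin m → Set Ω := fun q =>
    {ω | q.1 ≠ q.2 ∧ ∑ j, X ω q.1 j * X ω q.2 j ≤ n * minEntry Λ ^ 2 / 2} with hBpair
  set Bneg : Set Ω := {ω | ¬∀ i j, 0 ≤ X ω i j} with hBneg
  have prow : ∀ i, P.real (Brow i) ≤ 2 * Real.exp (-τ) := fun i =>
    h.bernstein_entries (e := fun j => (i, j)) (fun j j' hj => by simpa using hj)
      (mul_pos (hrc.row_pos i) hb0) (hrowb i) (by rwa [Fintype.card_fin]) hM hτ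
  have pcol : ∀ j, P.real (Bcol j) ≤ 2 * Real.exp (-τ) := fun j =>
    h.bernstein_entries (e := fun i => (i, j)) (fun i i' hi => by simpa using hi)
      (mul_pos (hrc.col_pos j) hb0) (hcolb j) (by rwa [Fintype.card_fin]) hM hτ
  have ppair : ∀ q, P.real (Bpair q) ≤ Real.exp (-(1 / 8 * alignmentRate Λ σ R)) := fun q => by
    by_cases hq : q.1 = q.2
    · simp only [hBpair, hq, ne_eq, not_true_eq_false, false_and]
      simpa using (Real.exp_pos _).le
    · refine (measureReal_mono fun ω hω => ?_).trans (h.row_alignment hm0 hn0 hq)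
      simp only [hBpair, Set.mem_ofPred_eq] at hω ⊢
      exact hω.2
  have pneg : P.real Bneg = 0 := by
    rw [measureReal_def, ENNReal.toReal_eq_zero_iff]
    left
    exact ae_iff.1 (ae_all_iff.2 fun i => ae_all_iff.2 fun j => h.nonneg i j)
  -- The potential event need not be measurable. Covering the whole space by it and the bad events
  -- uses only subadditivity, which holds for arbitrary sets.
  have hcover : Set.univ ⊆ potentialEvent X r c α β (4 * CStar Λ δ K * ε) ∪ (Bneg ∪
      ((⋃ i, Brow i) ∪ ((⋃ j, Bcol j) ∪ ⋃ q, Bpair q))) := by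
    intro ω _
    by_contra hω
    simp only [Set.mem_union, Set.mem_iUnion, not_or, not_exists] at hω
    obtain ⟨hω0, hω1, hω2, hω3, hω4⟩ := hω
    simp only [hBneg, hBrow, hBcol, hBpair, Set.mem_ofPred_eq, not_not, not_and, not_le]
      at hω1 hω2 hω3 hω4
    refine hω0 (potentials_stable hrc hΛ hK hαβ hε0 hε hω1 (fun i => ?_) (fun j => ?_)
      fun i k hik => (hω4 (i, k) hik).le)
    · have e : (∑ j, Real.exp (α i) * Real.exp (β j) * X ω i j) - r i =
          ∑ j, Real.exp (α i) * Real.exp (β j) * (X ω i j - Λ i j) := by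
        rw [← hΛrow i, ← Finset.sum_sub_distrib]
        exact Finset.sum_congr rfl fun j _ => by ring
      rw [e]
      exact (hω2 i).le.trans_eq (by rw [hεdef]; ring)
    · have e : (∑ i, Real.exp (α i) * Real.exp (β j) * X ω i j) - c j =
          ∑ i, Real.exp (α i) * Real.exp (β j) * (X ω i j - Λ i j) := by
        rw [← hΛcol j, ← Finset.sum_sub_distrib]
        exact Finset.sum_congr rfl fun i _ => by ring
      rw [e]
      exact (hω3 j).le.trans_eq (by rw [hεdef]; ring)
  have hmeas := measureReal_mono (μ := P) hcover
  rw [probReal_univ] at hmeas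
  have h1 := measureReal_union_le (μ := P) (potentialEvent X r c α β (4 * CStar Λ δ K * ε)) (Bneg ∪
      ((⋃ i, Brow i) ∪ ((⋃ j, Bcol j) ∪ ⋃ q, Bpair q)))
  have h2 := measureReal_union_le (μ := P) Bneg
      ((⋃ i, Brow i) ∪ ((⋃ j, Bcol j) ∪ ⋃ q, Bpair q))
  have h3 := measureReal_union_le (μ := P) (⋃ i, Brow i) ((⋃ j, Bcol j) ∪ ⋃ q, Bpair q)
  have h4 := measureReal_union_le (μ := P) (⋃ j, Bcol j) (⋃ q, Bpair q)
  have h5 : P.real (⋃ i, Brow i) ≤ m * (2 * Real.exp (-τ)) := by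
    refine (measureReal_iUnion_fintype_le _).trans ((Finset.sum_le_sum fun i _ => prow i).trans ?_)
    simp
  have h6 : P.real (⋃ j, Bcol j) ≤ n * (2 * Real.exp (-τ)) := by
    refine (measureReal_iUnion_fintype_le _).trans ((Finset.sum_le_sum fun i _ => pcol i).trans ?_)
    simp
  have h7 : P.real (⋃ q, Bpair q) ≤
      (m : ℝ) ^ 2 * Real.exp (-(1 / 8 * alignmentRate Λ σ R)) := by
    refine (measureReal_iUnion_fintype_le _).trans ((Finset.sum_le_sum fun i _ => ppair i).trans ?_)
    simp [sq]
  have h8 : (m : ℝ) * (2 * Real.exp (-τ)) + n * (2 * Real.exp (-τ)) ≤ M ^ (-D) := by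
    rw [← hMτ]
    have := Real.exp_pos (-τ)
    nlinarith
  linarith

end Probability

end Sinkhorn

end

theorem mainTheorem2 :
    ∃ a : ℝ, 0 < a ∧
      ∀ (m n : ℕ) (Ω : Type*) [MeasurableSpace Ω] (P : Measure Ω) [IsProbabilityMeasure P]
        (X : Ω → Matrix (Fin m) (Fin n) ℝ) (Λ : Matrix (Fin m) (Fin n) ℝ)
        (r : Fin m → ℝ) (c : Fin n → ℝ) (δ σ R K D : ℝ),
        Sinkhorn.IsSmoothMargin δ r c →
        Sinkhorn.IsSubexponential P X Λ σ R →
        Sinkhorn.BoundedCost Λ r c K →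
        0 < D →
        Sinkhorn.eps0 Λ δ K σ R D ≤ 1 / (50 * Sinkhorn.CStar Λ δ K ^ 2) →
        (∃ (α : Fin m → ℝ) (β : Fin n → ℝ), Sinkhorn.IsSchrodingerPotential Λ r c α β) ∧
        ∀ (α : Fin m → ℝ) (β : Fin n → ℝ), Sinkhorn.IsSchrodingerPotential Λ r c α β →
          1 - ((max m n : ℕ) : ℝ) ^ (-D)
              - (m : ℝ) ^ 2 * Real.exp (-(a * Sinkhorn.alignmentRate Λ σ R))
            ≤ P.real (Sinkhorn.potentialEvent X r c α β
                (4 * Sinkhorn.CStar Λ δ K * Sinkhorn.eps0 Λ δ K σ R D)) := by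
  refine ⟨1 / 8, by norm_num, ?_⟩
  intro m n Ω _ P _ X Λ r c δ σ R K D hrc hX hK hD hε
  exact ⟨Sinkhorn.exists_isSchrodingerPotential_of_pos hX.mean_pos hrc.m_pos hrc.n_pos
    hrc.row_pos hrc.col_pos hrc.sum_eq, fun α β hαβ =>
    hX.le_measureReal_potentialEvent hrc hK hD hε hαβ⟩
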